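/- **Setting.** Let $\Gamma\subset\mathbb R^n$ be a bounded network: a connected union of finitely many straight closed segments (edges) $\Gamma_\alpha$, $\alpha\in\mathcal A$, $\mathcal A\neq\emptyset$, of lengths $\ell_\alpha>0$, joining distinct vertices $\nu_i$, $i\in I$; every vertex is an endpoint of some edge, a vertex lies on an edge only as one of its endpoints, and two different edges meet in the empty set or in a single vertex. Let $\mathcal V$ be the set of vertices and $\mathcal A_i=\{\alpha:\nu_i\in\Gamma_\alpha\}$. Each edge is oriented arbitrarily, say from $\nu_i$ to $\nu_j$, and parametrized by $\pi_\alpha:[0,\ell_\alpha]\to\Gamma_\alpha$, $\pi_\alpha(y)=\big((\ell_\alpha-y)\nu_i+y\nu_j\big)/\ell_\alpha$. For $g:\Gamma\to\mathbb R$ put $g_\alpha=g\circ\pi_\alpha$ on $(0,\ell_\alpha)$, extended to $[0,\ell_\alpha]$ by its one-sided limits at the endpoints when they exist; $\partial$ denotes differentiation in $y$. Set $\int_\Gamma g\,dx=\sum_\alpha\int_0^{\ell_\alpha}g_\alpha\,dy$. Let $PC(\Gamma)$ be the set of $g$ such that every $g_\alpha$ is continuous on $(0,\ell_\alpha)$ and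 extends continuously to $[0,\ell_\alpha]$, with $\|g\|_{L^\infty(\Gamma)}=\max_\alpha\max_{[0,\ell_\alpha]}|g_\alpha|$. Let $C^m(\Gamma)$ be the set of continuous $v:\Gamma\to\mathbb R$ with $v_\alpha\in C^m([0,\ell_\alpha])$ for all $\alpha$, with norm $\|v\|_{C^m(\Gamma)}=\sum_\alpha\sum_{k\le m}\|\partial^kv_\alpha\|_\infty$; let $C^{m,\sigma}(\Gamma)$ be the set of $v\in C^m(\Gamma)$ with $\partial^mv_\alpha\in C^{0,\sigma}([0,\ell_\alpha])$ for all $\alpha$, with norm $\|v\|_{C^m(\Gamma)}+\sup_\alpha\sup_{y\ne z}|\partial^mv_\alpha(y)-\partial^mv_\alpha(z)|/|y-z|^\sigma$. For $\alpha\in\mathcal A_i$ the outward derivative is $\partial_\alpha v(\nu_i)=-\partial v_\alpha(0)$ if $\nu_i=\pi_\alpha(0)$, and $\partial_\alpha v(\nu_i)=\partial v_\alpha(\ell_\alpha)$ if $\nu_i=\pi_\alpha(\ell_\alpha)$. Let $\mu_\alpha>0$, and $\gamma_{i\alpha}>0$ for $\alpha\in\mathcal A_i$, with $\sum_{\alpha\in\mathcal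 A_i}\gamma_{i\alpha}\mu_\alpha=1$ for every $i$. Let $q\in(1,2]$, $C_0,C_1>0$, and let $H:\Gamma\times\mathbb R\to\mathbb R$ be such that, for every $\alpha$, (i) $H_\alpha\in C^1([0,\ell_\alpha]\times\mathbb R)$, (ii) $H_\alpha(y,\cdot)$ is convex for each $y\in[0,\ell_\alpha]$, and (iii) $H_\alpha(y,p)\ge C_0|p|^q-C_1$ on $[0,\ell_\alpha]\times\mathbb R$. Let $f\in PC(\Gamma)$. **Theorem.** (a) There is a unique pair $(v,\rho)\in C^2(\Gamma)\times\mathbb R$ such that $$-\mu_\alpha\partial^2v_\alpha(y)+H_\alpha(y,\partial v_\alpha(y))+\rho=f_\alpha(y)\quad\text{for all }\alpha\in\mathcal A,\ y\in(0,\ell_\alpha),$$ $$\sum_{\alpha\in\mathcal A_i}\gamma_{i\alpha}\mu_\alpha\,\partial_\alpha v(\nu_i)=0\ \text{ for all } i\in I,\qquad \int_\Gamma v\,dx=0 .$$ Moreover $|\rho|\le\max_{\alpha}\max_{y\in[0,\ell_\alpha]}|H_\alpha(y,0)-f_\alpha(y)|$. (b) $\|v\|_{C^2(\Gamma)}\le\overline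 C$, where $\overline C$ depends only on $\Gamma$, $(\mu_\alpha)$, $(\gamma_{i\alpha})$, $q$, $C_0$, $C_1$, an upper bound for $\|f\|_{L^\infty(\Gamma)}$, and a function $B:\mathbb R\to\mathbb R$ such that $|H_\alpha|\le B(r)$ on $[0,\ell_\alpha]\times[-r,r]$ for all $\alpha$ and $r\ge0$. In particular, for fixed $H$ the bound depends on $f$ only through $\|f\|_{L^\infty(\Gamma)}$. (c) Let $\sigma\in(0,1)$ and suppose that $f_\alpha\in C^{0,\sigma}([0,\ell_\alpha])$ for all $\alpha$. Then $v\in C^{2,\sigma}(\Gamma)$, and $\|v\|_{C^{2,\sigma}(\Gamma)}\le\overline C$, where $\overline C$ depends only on $\sigma$, $\Gamma$, $(\mu_\alpha)$, $(\gamma_{i\alpha})$, $q$, $C_0$, $C_1$, an upper bound for the norms $\|f_\alpha\|_{C^{0,\sigma}([0,\ell_\alpha])}$, a function $B$ as in (b), and a function $L:\mathbb R\to\mathbb R$ such that $L(r)$ is a Lipschitz constant of $H_\alpha$ on $[0,\ell_\alpha]\times[-r,r]$, with respect to $|y-z|+|p-p'|$, for all $\alpha$ and $r\ge0$. -/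

import Mathlib

open Set Filter Topology

noncomputable section

/-- A bounded network in `ℝⁿ`: a connected union of finitely many straight segments (the closed
edges), indexed by `A`, joining vertices indexed by `I`.  The edge `α` joins the two distinct
vertices `src α` and `tgt α` and is oriented from the former to the latter; the orientation is
arbitrary.  Two different edges meet in the empty set or in exactly one vertex, a vertex lies on
an edge only as one of its endpoints, and every vertex is an endpoint of some edge. -/
structure Network (n : ℕ) (I A : Type*) [Fintype I] [Fintype A] where
  vertex : I → EuclideanSpace ℝ (Fin n)
  vertex_injective : Function.Injective vertex
  src : A → I
  tgt : A → I
  src_ne_tgt : ∀ α, src α ≠ tgt α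
  inter_edges : ∀ α β, α ≠ β →
    (segment ℝ (vertex (src α)) (vertex (tgt α)) ∩
        segment ℝ (vertex (src β)) (vertex (tgt β)) = ∅ ∨
      ∃ i, segment ℝ (vertex (src α)) (vertex (tgt α)) ∩
        segment ℝ (vertex (src β)) (vertex (tgt β)) = {vertex i})
  vertex_mem_edge : ∀ i α,
    vertex i ∈ segment ℝ (vertex (src α)) (vertex (tgt α)) → i = src α ∨ i = tgt α
  vertex_endpoint : ∀ i, ∃ α, i = src α ∨ i = tgt α
  connected : IsConnected (⋃ α, segment ℝ (vertex (src α)) (vertex (tgt α)))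

namespace Network

variable {n : ℕ} {I A : Type*} [Fintype I] [Fintype A] (N : Network n I A)

/-- The closed edge `Γ_α`. -/
def edge (α : A) : Set (EuclideanSpace ℝ (Fin n)) :=
  segment ℝ (N.vertex (N.src α)) (N.vertex (N.tgt α))

/-- The network `Γ` as a subset of `ℝⁿ`. -/
def carrier : Set (EuclideanSpace ℝ (Fin n)) := ⋃ α, N.edge α

/-- The length `ℓ_α` of an edge. -/
def len (α : A) : ℝ := dist (N.vertex (N.src α)) (N.vertex (N.tgt α))

theorem len_pos (α : A) : 0 < N.len α :=
  dist_pos.2 fun h => N.src_ne_tgt α (N.vertex_injective h)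

open Classical in
/-- The set `𝒜_i` of the edges that contain the vertex `ν_i`. -/
def inc (i : I) : Finset A := Finset.univ.filter fun α => N.vertex i ∈ N.edge α

theorem lineMap_mem_carrier (α : A) (y : Icc (0 : ℝ) (N.len α)) :
    AffineMap.lineMap (N.vertex (N.src α)) (N.vertex (N.tgt α)) ((y : ℝ) / N.len α) ∈
      N.carrier := by
  refine mem_iUnion.2 ⟨α, ?_⟩
  rw [edge, segment_eq_image_lineMap]
  exact ⟨_, ⟨div_nonneg y.2.1 (N.len_pos α).le, (div_le_one (N.len_pos α)).2 y.2.2⟩, rfl⟩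

/-- The arc-length parametrization `π_α : [0, ℓ_α] → Γ_α`, that is
`π_α(y) = ((ℓ_α - y) ν_i + y ν_j) / ℓ_α` for an edge oriented from `ν_i` to `ν_j`. -/
def param (α : A) (y : Icc (0 : ℝ) (N.len α)) : N.carrier :=
  ⟨_, N.lineMap_mem_carrier α y⟩

/-- `f ∘ π_α` on `[0, ℓ_α]` (extended by constants outside so as to be defined on `ℝ`). -/
def pullback (f : N.carrier → ℝ) (α : A) : ℝ → ℝ :=
  IccExtend (N.len_pos α).le fun y => f (N.param α y)

open Classical in
/-- The function `f_α` of an edge: `f ∘ π_α` on `(0, ℓ_α)`, and at the two endpoints the limit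
from inside the edge.  Only its values on `[0, ℓ_α]` are ever used.  The values of `f` itself at
the vertices play no role, so `f` may have different limits along different edges. -/
def onEdge (f : N.carrier → ℝ) (α : A) (y : ℝ) : ℝ :=
  if y ∈ Ioo 0 (N.len α) then N.pullback f α y
  else limUnder (𝓝[Ioo 0 (N.len α)] y) (N.pullback f α)

/-- `H_α(y, p)` for a Hamiltonian `H : Γ × ℝ → ℝ`, extended to `[0, ℓ_α] × ℝ` in the same way. -/
def hamOnEdge (H : N.carrier → ℝ → ℝ) (α : A) (y p : ℝ) : ℝ :=
  N.onEdge (fun x => H x p) α y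

/-- Piecewise continuous functions, `PC(Γ)`. -/
def IsPC (f : N.carrier → ℝ) : Prop :=
  ∀ α, ContinuousOn (N.onEdge f α) (Icc 0 (N.len α))

/-- The space `C^m(Γ)`. -/
def IsCm (m : ℕ) (v : N.carrier → ℝ) : Prop :=
  Continuous v ∧ ∀ α, ContDiffOn ℝ m (N.onEdge v α) (Icc 0 (N.len α))

/-- The derivative `∂^k v_α` on `[0, ℓ_α]` (one-sided at the endpoints). -/
def edgeDeriv (k : ℕ) (v : N.carrier → ℝ) (α : A) (y : ℝ) : ℝ :=
  iteratedDerivWithin k (N.onEdge v α) (Icc 0 (N.len α)) y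

open Classical in
/-- The outward derivative `∂_α v(ν_i)` at an endpoint `ν_i` of the edge `α`: it is
`-∂v_α(0)` if `ν_i = π_α(0)` and `∂v_α(ℓ_α)` if `ν_i = π_α(ℓ_α)`. -/
def outwardDeriv (v : N.carrier → ℝ) (i : I) (α : A) : ℝ :=
  if i = N.src α then -N.edgeDeriv 1 v α 0 else N.edgeDeriv 1 v α (N.len α)

/-- The integral `∫_Γ v dx`. -/
def integral (v : N.carrier → ℝ) : ℝ := ∑ α, ∫ y in (0 : ℝ)..N.len α, N.onEdge v α y

/-- `max` over all edges `α` and all `y ∈ [0, ℓ_α]` of `|g_α(y)|`. -/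
def maxAbs (g : A → ℝ → ℝ) : ℝ :=
  ⨆ x : (Σ α : A, Icc (0 : ℝ) (N.len α)), |g x.1 (x.2 : ℝ)|

/-- The norm of `C^m(Γ)`. -/
def cmNorm (m : ℕ) (v : N.carrier → ℝ) : ℝ :=
  ∑ α, ∑ k ∈ Finset.range (m + 1), ⨆ y : Icc (0 : ℝ) (N.len α), |N.edgeDeriv k v α y|

/-- `g ∈ C^{0,σ}([0, ℓ])`. -/
def IsHolderOn (σ ℓ : ℝ) (g : ℝ → ℝ) : Prop :=
  ∃ K : ℝ, ∀ y ∈ Icc 0 ℓ, ∀ z ∈ Icc 0 ℓ, |g y - g z| ≤ K * |y - z| ^ σ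

/-- The Hölder seminorm on `[0, ℓ]`; the pairs with `y = z` contribute `0`. -/
def holderSeminorm (σ ℓ : ℝ) (g : ℝ → ℝ) : ℝ :=
  ⨆ x : Icc (0 : ℝ) ℓ × Icc (0 : ℝ) ℓ, |g x.1 - g x.2| / |(x.1 : ℝ) - x.2| ^ σ

/-- The norm of `C^{0,σ}([0, ℓ])`. -/
def holderNorm (σ ℓ : ℝ) (g : ℝ → ℝ) : ℝ :=
  (⨆ y : Icc (0 : ℝ) ℓ, |g y|) + holderSeminorm σ ℓ g

/-- The space `C^{m,σ}(Γ)`. -/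
def IsCmHolder (m : ℕ) (σ : ℝ) (v : N.carrier → ℝ) : Prop :=
  N.IsCm m v ∧ ∀ α, IsHolderOn σ (N.len α) (N.edgeDeriv m v α)

/-- The norm of `C^{m,σ}(Γ)`. -/
def cmHolderNorm (m : ℕ) (σ : ℝ) (v : N.carrier → ℝ) : ℝ :=
  N.cmNorm m v + ⨆ α, holderSeminorm σ (N.len α) (N.edgeDeriv m v α)

/-- The assumptions on the Hamiltonian: `H_α ∈ C¹([0, ℓ_α] × ℝ)`, `H_α(y, ·)` is convex, and
`H_α(y, p) ≥ C₀ |p|^q - C₁`. -/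
structure IsHamiltonian (q C₀ C₁ : ℝ) (H : N.carrier → ℝ → ℝ) : Prop where
  contDiff : ∀ α, ContDiffOn ℝ 1 (fun z : ℝ × ℝ => N.hamOnEdge H α z.1 z.2)
    (Icc 0 (N.len α) ×ˢ univ)
  convex : ∀ α, ∀ y ∈ Icc 0 (N.len α), ConvexOn ℝ univ (N.hamOnEdge H α y)
  coercive : ∀ α, ∀ y ∈ Icc 0 (N.len α), ∀ p : ℝ, C₀ * |p| ^ q - C₁ ≤ N.hamOnEdge H α y p

/-- `B r` bounds `|H_α|` on `[0, ℓ_α] × [-r, r]`, for every `α` and `r`. -/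
def HamBound (B : ℝ → ℝ) (H : N.carrier → ℝ → ℝ) : Prop :=
  ∀ α, ∀ r : ℝ, ∀ y ∈ Icc 0 (N.len α), ∀ p : ℝ, |p| ≤ r → |N.hamOnEdge H α y p| ≤ B r

/-- `L r` is a Lipschitz constant of `H_α` on `[0, ℓ_α] × [-r, r]`, for every `α` and `r`. -/
def HamLipschitz (L : ℝ → ℝ) (H : N.carrier → ℝ → ℝ) : Prop :=
  ∀ α, ∀ r : ℝ, ∀ y ∈ Icc 0 (N.len α), ∀ z ∈ Icc 0 (N.len α), ∀ p p' : ℝ, |p| ≤ r → |p'| ≤ r →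
    |N.hamOnEdge H α y p - N.hamOnEdge H α z p'| ≤ L r * (|y - z| + |p - p'|)

/-- `(v, ρ) ∈ C²(Γ) × ℝ` is a classical solution of the ergodic problem with `∫_Γ v dx = 0`.
Continuity of `v` at the vertices is part of `v ∈ C²(Γ)`. -/
structure IsErgodicSolution (μ : A → ℝ) (γ : I → A → ℝ) (H : N.carrier → ℝ → ℝ)
    (f : N.carrier → ℝ) (v : N.carrier → ℝ) (ρ : ℝ) : Prop where
  isC2 : N.IsCm 2 v
  equation : ∀ α, ∀ y ∈ Ioo 0 (N.len α),
    -μ α * N.edgeDeriv 2 v α y + N.hamOnEdge H α y (N.edgeDeriv 1 v α y) + ρ = N.onEdge f α y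
  kirchhoff : ∀ i, ∑ α ∈ N.inc i, γ i α * μ α * N.outwardDeriv v i α = 0
  integral_eq_zero : N.integral v = 0

end Network

end

/-! With p = ∂v, the equation on an edge is the scalar first-order ODE μp' = H(y,p) - f + ρ, so the
problem reduces to finitely many unknowns: the vertex values V and the constant ρ.

Suppose first that the Hamiltonian is globally Lipschitz in p. Shooting shows that ρ and the
increment of v across an edge determine p, and that the slope with which p enters the edge is
strictly increasing in the increment and nonincreasing in ρ. The Kirchhoff conditions become
equations ∑ w Φ(V_i - V_j, ρ) = 0, with Φ strictly increasing in the difference and nondecreasing in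
ρ. To solve them (`IsNodalSystem.exists_solution`), take the smallest ρ for which some V makes all
these sums nonnegative; it exists by compactness. For this ρ choose such a V with the fewest
vanishing sums. If no sum vanished, ρ could be lowered; if only some did, raising V slightly at
those vertices would make another one positive, because the graph is connected. So all of them
vanish.

A general H is reached through a gradient bound (`IsKirchhoff.abs_deriv_le`). If p' ≥ Λ|p| - C, a
large slope entering an edge is amplified by about exp(Λℓ) before it leaves. For Λ large compared
with the weights, this contradicts the Kirchhoff condition at a vertex with the largest outward
slope, unless that slope is bounded. Growth of order q > 1 provides every Λ. Since ρ is bounded by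
the maximum principle, H can be replaced at large p by a Lipschitz function with the same lower
bound; the solution then never sees the change.

Uniqueness follows from the maximum principle for a difference of two solutions. At a vertex maximum
all outward slopes are nonnegative with weighted sum zero, hence vanish, and ODE uniqueness spreads
the maximum over the connected network.

For the estimates, the gradient bound is uniform in the data, the zero mean then bounds v, and the
equation bounds v'' and its Hölder seminorm. -/

/-! ### Scalar ODEs on one edge: differential inequalities and the initial value problem. -/

section EdgeODE

open MeasureTheory

theorem hasDerivWithinAt_Ici_of_Icc {f : ℝ → ℝ} {f' a b y : ℝ} (hy : y ∈ Ico a b)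
    (h : HasDerivWithinAt f f' (Icc a b) y) : HasDerivWithinAt f f' (Ici y) y := by
  refine h.mono_of_mem_nhdsWithin ?_
  exact mem_of_superset (Icc_mem_nhdsGE hy.2) (Icc_subset_Icc_left hy.1)

theorem continuousOn_of_forall_hasDerivWithinAt {f f' : ℝ → ℝ} {s : Set ℝ}
    (h : ∀ y ∈ s, HasDerivWithinAt f (f' y) s y) : ContinuousOn f s :=
  fun y hy => (h y hy).continuousWithinAt

/-- The truncation of `p` to `[-M, M]`. -/
def clamp (M p : ℝ) : ℝ := max (-M) (min M p)

theorem abs_clamp_le {M : ℝ} (hM : 0 ≤ M) (p : ℝ) : |clamp M p| ≤ M :=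
  abs_le.2 ⟨le_max_left _ _, max_le (by linarith) (min_le_left _ _)⟩

theorem clamp_eq_self {M p : ℝ} (hp : |p| ≤ M) : clamp M p = p := by
  rw [abs_le] at hp
  rw [clamp, min_eq_right hp.2, max_eq_right hp.1]

theorem abs_clamp_eq {M : ℝ} (hM : 0 ≤ M) (p : ℝ) : |clamp M p| = min M |p| := by
  rcases le_total |p| M with h | h
  · rw [clamp_eq_self h, min_eq_right h]
  · rw [min_eq_left h]
    rcases abs_cases p with ⟨h1, -⟩ | ⟨h1, -⟩
    · rw [clamp, min_eq_left (by linarith), max_eq_right (by linarith), abs_of_nonneg hM]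
    · rw [clamp, min_eq_right (by linarith), max_eq_left (by linarith), abs_neg, abs_of_nonneg hM]

theorem abs_clamp_le_abs {M : ℝ} (hM : 0 ≤ M) (p : ℝ) : |clamp M p| ≤ |p| :=
  (abs_clamp_eq hM p).trans_le (min_le_right _ _)

theorem abs_clamp_sub_clamp_le (M p p' : ℝ) : |clamp M p - clamp M p'| ≤ |p - p'| := by
  refine (abs_max_sub_max_le_max _ _ _ _).trans ?_
  rw [sub_self, abs_zero]
  refine max_le (abs_nonneg _) ((abs_min_sub_min_le_max _ _ _ _).trans ?_)
  simp

/-- A function with `q' ≥ -L|q|` that starts nonnegative stays nonnegative. -/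
theorem nonneg_of_neg_mul_abs_le_deriv {q q' : ℝ → ℝ} {a b L : ℝ}
    (hq : ∀ y ∈ Icc a b, HasDerivWithinAt q (q' y) (Icc a b) y)
    (h : ∀ y ∈ Icc a b, -(L * |q y|) ≤ q' y) (ha : 0 ≤ q a) : ∀ y ∈ Icc a b, 0 ≤ q y := by
  intro y hy
  have key : ∀ ε : ℝ, 0 < ε → -q y ≤ ε * Real.exp ((L + 1) * (y - a)) := by
    intro ε hε
    -- The barrier grows at rate L + 1, while at a contact point -q' ≤ L|q|, so contact cannot
    -- become crossing. Then ε is made small.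
    refine image_le_of_deriv_right_lt_deriv_boundary' (f := fun y => -q y) (f' := fun y => -q' y)
      (B := fun y => ε * Real.exp ((L + 1) * (y - a)))
      (B' := fun y => ε * (Real.exp ((L + 1) * (y - a)) * (L + 1)))
      (continuousOn_of_forall_hasDerivWithinAt hq).neg
      (fun x hx => (hasDerivWithinAt_Ici_of_Icc hx (hq x (Ico_subset_Icc_self hx))).neg) ?_ ?_ ?_ ?_
      hy
    · simp; linarith
    · fun_prop
    · intro x _
      have h1 : HasDerivAt (fun y => (L + 1) * (y - a)) (L + 1) x := by
        simpa using ((hasDerivAt_id x).sub_const a).const_mul (L + 1)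
      exact (h1.exp.const_mul ε).hasDerivWithinAt
    · intro x hx hB
      have hx' := h x (Ico_subset_Icc_self hx)
      have hpos : 0 < ε * Real.exp ((L + 1) * (x - a)) := by positivity
      have habs : |q x| = ε * Real.exp ((L + 1) * (x - a)) := by
        rw [← hB, abs_of_neg (by linarith)]
      rw [habs] at hx'
      nlinarith
  by_contra! hneg
  have hE := Real.exp_pos ((L + 1) * (y - a))
  have := key (-q y / (2 * Real.exp ((L + 1) * (y - a)))) (by apply div_pos <;> linarith)
  have h2 : -q y / (2 * Real.exp ((L + 1) * (y - a))) * Real.exp ((L + 1) * (y - a)) = -q y / 2 := by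
    field_simp
  rw [h2] at this
  linarith

/-- A function with `q' ≥ k q` grows at least like `exp (k y)`. -/
theorem mul_exp_le_of_mul_le_deriv {q q' : ℝ → ℝ} {a b k : ℝ}
    (hq : ∀ y ∈ Icc a b, HasDerivWithinAt q (q' y) (Icc a b) y)
    (h : ∀ y ∈ Icc a b, k * q y ≤ q' y) {x y : ℝ} (hx : x ∈ Icc a b) (hy : y ∈ Icc a b)
    (hxy : x ≤ y) : q x * Real.exp (k * (y - x)) ≤ q y := by
  have hd : ∀ z ∈ Icc a b, HasDerivWithinAt (fun z => q z * Real.exp (-(k * z)))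
      (q' z * Real.exp (-(k * z)) + q z * (Real.exp (-(k * z)) * -k)) (Icc a b) z := by
    intro z hz
    have h1 : HasDerivAt (fun z => -(k * z)) (-k) z := by
      simpa using ((hasDerivAt_id z).const_mul k).fun_neg
    exact (hq z hz).mul h1.exp.hasDerivWithinAt
  have hm : MonotoneOn (fun z => q z * Real.exp (-(k * z))) (Icc a b) := by
    refine monotoneOn_of_hasDerivWithinAt_nonneg (convex_Icc a b)
      (continuousOn_of_forall_hasDerivWithinAt hd)
      (fun z hz => (hd z (interior_subset hz)).mono interior_subset) ?_
    intro z hz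
    have := h z (interior_subset hz)
    have hE := Real.exp_pos (-(k * z))
    nlinarith
  have h1 := hm hx hy hxy
  simp only at h1
  have h2 := mul_le_mul_of_nonneg_right h1 (Real.exp_pos (k * y)).le
  rw [mul_assoc, mul_assoc, ← Real.exp_add, ← Real.exp_add] at h2
  rwa [show -(k * x) + k * y = k * (y - x) by ring, neg_add_cancel, Real.exp_zero, mul_one] at h2

/-- `p` solves `p' = h(y, p) + r` on `[0, ℓ]`. -/
def IsEdgeSolution (ℓ : ℝ) (h : ℝ → ℝ → ℝ) (r : ℝ) (p : ℝ → ℝ) : Prop :=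
  ∀ y ∈ Icc 0 ℓ, HasDerivWithinAt p (h y (p y) + r) (Icc 0 ℓ) y

/-- `h` is continuous in `y` and globally Lipschitz in `p` on `[0, ℓ] × ℝ`. -/
structure IsLipschitzField (ℓ L : ℝ) (h : ℝ → ℝ → ℝ) : Prop where
  lipschitz : ∀ y ∈ Icc 0 ℓ, ∀ p p', |h y p - h y p'| ≤ L * |p - p'|
  continuousOn : ∀ p, ContinuousOn (fun y => h y p) (Icc 0 ℓ)

variable {ℓ L : ℝ} {h : ℝ → ℝ → ℝ}

theorem IsEdgeSolution.continuousOn {r : ℝ} {p : ℝ → ℝ} (hp : IsEdgeSolution ℓ h r p) :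
    ContinuousOn p (Icc 0 ℓ) :=
  continuousOn_of_forall_hasDerivWithinAt hp

theorem IsEdgeSolution.intervalIntegrable (hℓ : 0 < ℓ) {r : ℝ} {p : ℝ → ℝ}
    (hp : IsEdgeSolution ℓ h r p) : IntervalIntegrable p volume 0 ℓ :=
  ContinuousOn.intervalIntegrable (by rw [uIcc_of_le hℓ.le]; exact hp.continuousOn)

theorem IsLipschitzField.nonneg (hℓ : 0 < ℓ) (hh : IsLipschitzField ℓ L h) : 0 ≤ L := by
  have := hh.lipschitz 0 ⟨le_rfl, hℓ.le⟩ 1 0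
  simp only [sub_zero, abs_one, mul_one] at this
  exact (abs_nonneg _).trans this

theorem IsLipschitzField.reverse (hh : IsLipschitzField ℓ L h) :
    IsLipschitzField ℓ L (fun y p => h (ℓ - y) (-p)) where
  lipschitz y hy p p' := by
    have := hh.lipschitz (ℓ - y) ⟨by linarith [hy.2], by linarith [hy.1]⟩ (-p) (-p')
    rwa [show -p - -p' = -(p - p') by ring, abs_neg] at this
  continuousOn p := by
    refine (hh.continuousOn (-p)).comp (by fun_prop) ?_
    intro y hy
    exact ⟨by linarith [hy.2], by linarith [hy.1]⟩

theorem IsEdgeSolution.reverse {r : ℝ} {p : ℝ → ℝ} (hp : IsEdgeSolution ℓ h r p) :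
    IsEdgeSolution ℓ (fun y p => h (ℓ - y) (-p)) r (fun y => -p (ℓ - y)) := by
  intro y hy
  have hm : MapsTo (fun y => ℓ - y) (Icc 0 ℓ) (Icc 0 ℓ) := fun z hz =>
    ⟨by linarith [hz.2], by linarith [hz.1]⟩
  have h1 : HasDerivWithinAt (fun y => ℓ - y) (-1) (Icc 0 ℓ) y :=
    ((hasDerivAt_id y).const_sub ℓ).hasDerivWithinAt
  have h2 := (HasDerivWithinAt.comp y (hp (ℓ - y) (hm hy)) h1 hm).fun_neg
  simpa [Function.comp_def] using h2

/-- Global solvability of the initial value problem. -/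
theorem IsLipschitzField.exists_solution (hℓ : 0 < ℓ) (hh : IsLipschitzField ℓ L h) (s r : ℝ) :
    ∃ p, p 0 = s ∧ IsEdgeSolution ℓ h r p := by
  have hL := hh.nonneg hℓ
  obtain ⟨m, hm⟩ := isCompact_Icc.exists_bound_of_continuousOn (hh.continuousOn 0)
  have hm0 : 0 ≤ m := (norm_nonneg _).trans (hm 0 ⟨le_rfl, hℓ.le⟩)
  have hbd : ∀ y ∈ Icc 0 ℓ, ∀ p, |h y p + r| ≤ L * |p| + (m + |r|) := by
    intro y hy p
    have h1 := hh.lipschitz y hy p 0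
    have h2 : |h y 0| ≤ m := hm y hy
    rw [sub_zero] at h1
    have := abs_sub_abs_le_abs_sub (h y p) (h y 0)
    have := abs_add_le (h y p) r
    linarith
  -- Clamping the argument at the Grönwall bound makes the field bounded, so Picard-Lindelöf applies
  -- on the whole edge. The clamped field has the same linear growth, so its solution stays below M
  -- and the clamp is inactive.
  set M := gronwallBound |s| L (m + |r|) ℓ with hM
  have hsM : |s| ≤ M := by
    have := gronwallBound_mono (δ := |s|) (K := L) (ε := m + |r|) (by positivity) (by positivity)
      hL hℓ.le
    rwa [gronwallBound_x0] at this
  have hM0 : 0 ≤ M := (abs_nonneg s).trans hsM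
  set G : ℝ → ℝ → ℝ := fun y p => h y (clamp M p) + r with hG
  set B : NNReal := ⟨L * M + (m + |r|), by positivity⟩ with hB
  have hPL : IsPicardLindelof G (tmin := 0) (tmax := ℓ) ⟨0, le_rfl, hℓ.le⟩ s
      (B * ⟨ℓ, hℓ.le⟩) 0 B ⟨L, hL⟩ := by
    refine ⟨?_, ?_, ?_, ?_⟩
    · intro t ht
      refine LipschitzOnWith.of_dist_le_mul fun x _ y _ => ?_
      simp only [hG, Real.dist_eq, add_sub_add_right_eq_sub]
      exact (hh.lipschitz t ht _ _).trans (mul_le_mul_of_nonneg_left (abs_clamp_sub_clamp_le _ _ _) hL)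
    · intro x _
      exact (hh.continuousOn _).add continuousOn_const
    · intro t ht x _
      rw [Real.norm_eq_abs]
      refine (hbd t ht _).trans ?_
      change L * |clamp M x| + (m + |r|) ≤ L * M + (m + |r|)
      gcongr
      exact abs_clamp_le hM0 x
    · change (B : ℝ) * max (ℓ - 0) (0 - 0) ≤ (B : ℝ) * ℓ - 0
      simp [hℓ.le]
  obtain ⟨p, hp0, hp⟩ := hPL.exists_eq_forall_mem_Icc_hasDerivWithinAt₀
  simp only at hp0
  refine ⟨p, hp0, ?_⟩
  have hpM : ∀ y ∈ Icc 0 ℓ, |p y| ≤ M := by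
    intro y hy
    have h1 := norm_le_gronwallBound_of_norm_deriv_right_le (f := p) (δ := |s|) (K := L)
      (ε := m + |r|) (continuousOn_of_forall_hasDerivWithinAt hp)
      (fun x hx => hasDerivWithinAt_Ici_of_Icc hx (hp x (Ico_subset_Icc_self hx)))
      (by rw [hp0, Real.norm_eq_abs]) ?_ y hy
    · refine h1.trans ?_
      exact gronwallBound_mono (by positivity) (by positivity) hL (by linarith [hy.2])
    · intro x hx
      simp only [hG, Real.norm_eq_abs]
      refine (hbd x (Ico_subset_Icc_self hx) _).trans ?_
      have := mul_le_mul_of_nonneg_left (abs_clamp_le_abs hM0 (p x)) hL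
      linarith
  intro y hy
  have := hp y hy
  simp only [hG] at this
  rwa [clamp_eq_self (hpM y hy)] at this

end EdgeODE

/-! ### Shooting on one edge: the initial slope as a function of the increment and the constant. -/

section Shooting

open MeasureTheory

variable {ℓ L : ℝ} {h : ℝ → ℝ → ℝ}

/-- Comparison for solutions with ordered initial values and ordered constants. -/
theorem IsEdgeSolution.comparison (hℓ : 0 < ℓ) (hh : IsLipschitzField ℓ L h) {r₁ r₂ : ℝ}
    {p₁ p₂ : ℝ → ℝ} (h₁ : IsEdgeSolution ℓ h r₁ p₁) (h₂ : IsEdgeSolution ℓ h r₂ p₂)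
    (hr : r₂ ≤ r₁) (h0 : p₂ 0 ≤ p₁ 0) :
    ∀ y ∈ Icc 0 ℓ, (p₁ 0 - p₂ 0) * Real.exp (-(L * ℓ)) ≤ p₁ y - p₂ y := by
  have hL := hh.nonneg hℓ
  have hd : ∀ y ∈ Icc 0 ℓ, HasDerivWithinAt (fun y => p₁ y - p₂ y)
      (h y (p₁ y) + r₁ - (h y (p₂ y) + r₂)) (Icc 0 ℓ) y := fun y hy => (h₁ y hy).sub (h₂ y hy)
  have hb : ∀ y ∈ Icc 0 ℓ,
      -(L * |p₁ y - p₂ y|) ≤ h y (p₁ y) + r₁ - (h y (p₂ y) + r₂) := by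
    intro y hy
    have := (abs_le.1 (hh.lipschitz y hy (p₁ y) (p₂ y))).1
    linarith
  have hnn := nonneg_of_neg_mul_abs_le_deriv hd hb (by linarith)
  intro y hy
  have h0mem : (0 : ℝ) ∈ Icc 0 ℓ := ⟨le_rfl, hℓ.le⟩
  have hexp := mul_exp_le_of_mul_le_deriv (k := -L) hd (fun z hz => by
    have h1 := hb z hz
    rw [abs_of_nonneg (hnn z hz)] at h1
    linarith) h0mem hy hy.1
  refine le_trans ?_ hexp
  have : Real.exp (-(L * ℓ)) ≤ Real.exp (-L * (y - 0)) := by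
    apply Real.exp_le_exp.2
    nlinarith [hy.2]
  exact mul_le_mul_of_nonneg_left this (by linarith)

/-- Lipschitz dependence of the solutions on the initial value and on the constant. -/
theorem IsEdgeSolution.abs_sub_le (hℓ : 0 < ℓ) (hh : IsLipschitzField ℓ L h) {r₁ r₂ : ℝ}
    {p₁ p₂ : ℝ → ℝ} (h₁ : IsEdgeSolution ℓ h r₁ p₁) (h₂ : IsEdgeSolution ℓ h r₂ p₂) :
    ∀ y ∈ Icc 0 ℓ, |p₁ y - p₂ y| ≤
      2 * Real.exp ((L + 1) * ℓ) * (|p₁ 0 - p₂ 0| + |r₁ - r₂|) := by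
  have hL := hh.nonneg hℓ
  have hd : ∀ y ∈ Icc 0 ℓ, HasDerivWithinAt (fun y => p₁ y - p₂ y)
      (h y (p₁ y) + r₁ - (h y (p₂ y) + r₂)) (Icc 0 ℓ) y := fun y hy => (h₁ y hy).sub (h₂ y hy)
  intro y hy
  have h1 := norm_le_gronwallBound_of_norm_deriv_right_le (f := fun y => p₁ y - p₂ y)
      (δ := |p₁ 0 - p₂ 0|) (K := L + 1)
      (ε := |r₁ - r₂|) (continuousOn_of_forall_hasDerivWithinAt hd)
      (fun x hx => hasDerivWithinAt_Ici_of_Icc hx (hd x (Ico_subset_Icc_self hx)))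
      le_rfl (fun x hx => by
        have h2 := hh.lipschitz x (Ico_subset_Icc_self hx) (p₁ x) (p₂ x)
        have h3 := abs_add_le (h x (p₁ x) - h x (p₂ x)) (r₁ - r₂)
        simp only [Real.norm_eq_abs]
        rw [show h x (p₁ x) + r₁ - (h x (p₂ x) + r₂) = h x (p₁ x) - h x (p₂ x) + (r₁ - r₂) by ring]
        nlinarith [abs_nonneg (p₁ x - p₂ x)]) y hy
  rw [gronwallBound_of_K_ne_0 (by linarith)] at h1
  simp only [sub_zero, Real.norm_eq_abs] at h1
  have hE : Real.exp ((L + 1) * y) ≤ Real.exp ((L + 1) * ℓ) := by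
    apply Real.exp_le_exp.2
    nlinarith [hy.2]
  have hE0 := Real.exp_pos ((L + 1) * y)
  have ha := abs_nonneg (p₁ 0 - p₂ 0)
  have hb := abs_nonneg (r₁ - r₂)
  have hdiv : |r₁ - r₂| / (L + 1) ≤ |r₁ - r₂| := div_le_self hb (by linarith)
  have hdiv0 : 0 ≤ |r₁ - r₂| / (L + 1) := by positivity
  have h4 : |r₁ - r₂| / (L + 1) * (Real.exp ((L + 1) * y) - 1) ≤
      |r₁ - r₂| * Real.exp ((L + 1) * ℓ) := by nlinarith
  nlinarith [mul_le_mul_of_nonneg_left hE ha, Real.exp_pos ((L + 1) * ℓ)]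

/-- Expansivity of the map from the initial value to the integral: a gap between ordered solutions
shrinks at most by the factor exp(-Lℓ). -/
theorem IsEdgeSolution.integral_sub_le (hℓ : 0 < ℓ) (hh : IsLipschitzField ℓ L h) {r₁ r₂ : ℝ}
    {p₁ p₂ : ℝ → ℝ} (h₁ : IsEdgeSolution ℓ h r₁ p₁) (h₂ : IsEdgeSolution ℓ h r₂ p₂)
    (hr : r₂ ≤ r₁) (h0 : p₂ 0 ≤ p₁ 0) :
    (p₁ 0 - p₂ 0) * Real.exp (-(L * ℓ)) * ℓ ≤ (∫ y in (0 : ℝ)..ℓ, p₁ y) - ∫ y in (0 : ℝ)..ℓ, p₂ y := by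
  have hi₁ := h₁.intervalIntegrable hℓ
  have hi₂ := h₂.intervalIntegrable hℓ
  rw [← intervalIntegral.integral_sub hi₁ hi₂]
  have := intervalIntegral.integral_mono_on (μ := volume) hℓ.le
    (intervalIntegrable_const (c := (p₁ 0 - p₂ 0) * Real.exp (-(L * ℓ)))) (hi₁.sub hi₂)
    (h₁.comparison hℓ hh h₂ hr h0)
  simp only [intervalIntegral.integral_const, sub_zero, smul_eq_mul] at this
  linarith

theorem IsEdgeSolution.abs_integral_sub_le (hℓ : 0 < ℓ) (hh : IsLipschitzField ℓ L h)
    {r₁ r₂ : ℝ} {p₁ p₂ : ℝ → ℝ} (h₁ : IsEdgeSolution ℓ h r₁ p₁)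
    (h₂ : IsEdgeSolution ℓ h r₂ p₂) :
    |(∫ y in (0 : ℝ)..ℓ, p₁ y) - ∫ y in (0 : ℝ)..ℓ, p₂ y| ≤
      2 * Real.exp ((L + 1) * ℓ) * (|p₁ 0 - p₂ 0| + |r₁ - r₂|) * ℓ := by
  rw [← intervalIntegral.integral_sub (h₁.intervalIntegrable hℓ) (h₂.intervalIntegrable hℓ)]
  have := intervalIntegral.norm_integral_le_of_norm_le_const (a := 0) (b := ℓ)
    (f := fun y => p₁ y - p₂ y)
    (C := 2 * Real.exp ((L + 1) * ℓ) * (|p₁ 0 - p₂ 0| + |r₁ - r₂|)) (fun y hy => by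
      rw [uIoc_of_le hℓ.le] at hy
      exact h₁.abs_sub_le hℓ hh h₂ y ⟨hy.1.le, hy.2⟩)
  rwa [sub_zero, abs_of_pos hℓ] at this

/-- `S d r` is the initial value of the solution of `p' = h(y, p) + r` with `∫ p = d`. -/
structure IsShooting (ℓ : ℝ) (h : ℝ → ℝ → ℝ) (S : ℝ → ℝ → ℝ) : Prop where
  exists_solution : ∀ d r, ∃ p, IsEdgeSolution ℓ h r p ∧ p 0 = S d r ∧ ∫ y in (0 : ℝ)..ℓ, p y = d
  initial_eq : ∀ r p, IsEdgeSolution ℓ h r p → p 0 = S (∫ y in (0 : ℝ)..ℓ, p y) r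

/-- For fixed r, the map from the initial value to the integral is continuous and grows at rate at
least exp(-Lℓ)ℓ. It is therefore a bijection of ℝ, and S is its inverse. -/
theorem IsLipschitzField.exists_shooting (hℓ : 0 < ℓ) (hh : IsLipschitzField ℓ L h) :
    ∃ S, IsShooting ℓ h S := by
  have hL := hh.nonneg hℓ
  choose P hP0 hP using hh.exists_solution hℓ
  set J : ℝ → ℝ → ℝ := fun s r => ∫ y in (0 : ℝ)..ℓ, P s r y with hJ
  set c := Real.exp (-(L * ℓ)) * ℓ with hc
  have hc0 : 0 < c := mul_pos (Real.exp_pos _) hℓ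
  have hgrow : ∀ r s s', s' ≤ s → (s - s') * c ≤ J s r - J s' r := by
    intro r s s' hs
    have := (hP s r).integral_sub_le hℓ hh (hP s' r) le_rfl (by rw [hP0, hP0]; exact hs)
    rw [hP0, hP0, mul_assoc] at this
    exact this
  have hcont : ∀ r, Continuous fun s => J s r := by
    intro r
    refine (LipschitzWith.of_dist_le_mul (K := NNReal.mk (2 * Real.exp ((L + 1) * ℓ) * ℓ) (by positivity))
      fun s s' => ?_).continuous
    have := (hP s r).abs_integral_sub_le hℓ hh (hP s' r)
    rw [hP0, hP0, sub_self, abs_zero, add_zero] at this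
    rw [Real.dist_eq, Real.dist_eq]
    refine this.trans_eq ?_
    rw [NNReal.coe_mk]
    ring
  have hsurj : ∀ d r, ∃ s, J s r = d := by
    intro d r
    refine mem_range_of_exists_le_of_exists_ge (hcont r) ?_ ?_
    · refine ⟨-(|d - J 0 r| / c), ?_⟩
      have := hgrow r 0 (-(|d - J 0 r| / c)) (by rw [neg_nonpos]; positivity)
      rw [zero_sub, neg_neg, div_mul_cancel₀ _ hc0.ne'] at this
      linarith [neg_abs_le (d - J 0 r)]
    · refine ⟨|d - J 0 r| / c, ?_⟩
      have := hgrow r (|d - J 0 r| / c) 0 (by positivity)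
      rw [sub_zero, div_mul_cancel₀ _ hc0.ne'] at this
      linarith [le_abs_self (d - J 0 r)]
  choose S hS using hsurj
  refine ⟨S, fun d r => ⟨P (S d r) r, hP _ _, hP0 _ _, hS d r⟩, fun r p hp => ?_⟩
  set d := ∫ y in (0 : ℝ)..ℓ, p y with hd
  have hSd := hS d r
  simp only [hJ] at hSd
  rcases le_total (P (S d r) r 0) (p 0) with h1 | h1
  · have := hp.integral_sub_le hℓ hh (hP (S d r) r) le_rfl h1
    rw [← hd, hSd, sub_self, mul_assoc, hP0] at this
    rw [hP0] at h1
    nlinarith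
  · have := (hP (S d r) r).integral_sub_le hℓ hh hp le_rfl h1
    rw [← hd, hSd, sub_self, mul_assoc, hP0] at this
    rw [hP0] at h1
    nlinarith

namespace IsShooting

variable {S : ℝ → ℝ → ℝ}

theorem strictMono (hℓ : 0 < ℓ) (hh : IsLipschitzField ℓ L h) (hS : IsShooting ℓ h S) (r : ℝ) :
    StrictMono fun d => S d r := by
  intro d₁ d₂ hd
  obtain ⟨p₁, h₁, h₁', hi₁⟩ := hS.exists_solution d₁ r
  obtain ⟨p₂, h₂, h₂', hi₂⟩ := hS.exists_solution d₂ r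
  simp only [← h₁', ← h₂']
  by_contra! hle
  have := h₁.integral_sub_le hℓ hh h₂ le_rfl hle
  have h3 : 0 ≤ (p₁ 0 - p₂ 0) * Real.exp (-(L * ℓ)) * ℓ :=
    mul_nonneg (mul_nonneg (by linarith) (Real.exp_pos _).le) hℓ.le
  linarith

/-- A larger constant pushes the solution up, so the initial value cannot be larger if the integral
is to stay the same. -/
theorem antitone (hℓ : 0 < ℓ) (hh : IsLipschitzField ℓ L h) (hS : IsShooting ℓ h S) (d : ℝ) :
    Antitone fun r => S d r := by
  intro r₂ r₁ hr
  obtain ⟨p₁, h₁, h₁', hi₁⟩ := hS.exists_solution d r₁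
  obtain ⟨p₂, h₂, h₂', hi₂⟩ := hS.exists_solution d r₂
  simp only [← h₁', ← h₂']
  by_contra! hlt
  have := h₁.integral_sub_le hℓ hh h₂ hr hlt.le
  have h3 : 0 < (p₁ 0 - p₂ 0) * Real.exp (-(L * ℓ)) * ℓ :=
    mul_pos (mul_pos (by linarith) (Real.exp_pos _)) hℓ
  linarith

theorem continuous (hℓ : 0 < ℓ) (hh : IsLipschitzField ℓ L h) (hS : IsShooting ℓ h S) :
    Continuous fun z : ℝ × ℝ => S z.1 z.2 := by
  have hL := hh.nonneg hℓ
  set c := Real.exp (-(L * ℓ)) * ℓ with hc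
  have hc0 : 0 < c := mul_pos (Real.exp_pos _) hℓ
  set D := 2 * Real.exp ((L + 1) * ℓ) * ℓ with hD
  have hD0 : 0 < D := by positivity
  refine (LipschitzWith.of_dist_le_mul (K := NNReal.mk ((1 + D) / c) (by positivity))
      fun z z' => ?_).continuous
  obtain ⟨p₁, h₁, h₁', hi₁⟩ := hS.exists_solution z.1 z.2
  obtain ⟨p₂, h₂, h₂', hi₂⟩ := hS.exists_solution z'.1 z'.2
  -- `p₃` shares its constant with `p₁` and its initial value with `p₂`. Expansivity compares the
  -- first pair, Lipschitz dependence on the constant the second.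
  obtain ⟨p₃, h₃0, h₃⟩ := hh.exists_solution hℓ (p₂ 0) z.2
  have e1 : c * |p₁ 0 - p₂ 0| ≤ |(∫ y in (0 : ℝ)..ℓ, p₁ y) - ∫ y in (0 : ℝ)..ℓ, p₃ y| := by
    rw [← h₃0]
    rcases le_total (p₃ 0) (p₁ 0) with hle | hle
    · have := h₁.integral_sub_le hℓ hh h₃ le_rfl hle
      rw [abs_of_nonneg (sub_nonneg.2 hle)]
      refine le_trans ?_ (le_abs_self _)
      linarith
    · have := h₃.integral_sub_le hℓ hh h₁ le_rfl hle
      rw [abs_sub_comm, abs_of_nonneg (sub_nonneg.2 hle), abs_sub_comm]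
      refine le_trans ?_ (le_abs_self _)
      linarith
  have e2 := h₂.abs_integral_sub_le hℓ hh h₃
  rw [h₃0, sub_self, abs_zero, zero_add] at e2
  have e3 := abs_sub_le (∫ y in (0 : ℝ)..ℓ, p₁ y) (∫ y in (0 : ℝ)..ℓ, p₂ y)
    (∫ y in (0 : ℝ)..ℓ, p₃ y)
  rw [hi₁, hi₂] at e3
  rw [hi₁] at e1
  rw [hi₂] at e2
  have hz1 : |z.1 - z'.1| ≤ dist z z' := by
    rw [← Real.dist_eq, Prod.dist_eq]; exact le_max_left _ _
  have hz2 : |z'.2 - z.2| ≤ dist z z' := by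
    rw [abs_sub_comm, ← Real.dist_eq, Prod.dist_eq]; exact le_max_right _ _
  rw [Real.dist_eq, ← h₁', ← h₂', NNReal.coe_mk, div_mul_eq_mul_div, le_div_iff₀ hc0]
  have := mul_le_mul_of_nonneg_left hz2 hD0.le
  have e4 : 2 * Real.exp ((L + 1) * ℓ) * |z'.2 - z.2| * ℓ = D * |z'.2 - z.2| := by
    rw [hD]; ring
  linarith

theorem exists_le (hℓ : 0 < ℓ) (hh : IsLipschitzField ℓ L h) (hS : IsShooting ℓ h S) (r M : ℝ) :
    ∃ d, M ≤ S d r := by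
  obtain ⟨p, hp0, hp⟩ := hh.exists_solution hℓ M r
  exact ⟨_, (hp0.symm.trans (hS.initial_eq r p hp)).le⟩

/-- Zero is a subsolution here, so a solution with positive initial value stays nonnegative and has
positive integral. This makes V = 0 a supersolution of the nodal system for large ρ. -/
theorem zero_nonpos (hℓ : 0 < ℓ) (hh : IsLipschitzField ℓ L h) (hS : IsShooting ℓ h S) {r : ℝ}
    (hr : ∀ y ∈ Icc 0 ℓ, 0 ≤ h y 0 + r) : S 0 r ≤ 0 := by
  obtain ⟨p, hp, hp', hi⟩ := hS.exists_solution 0 r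
  rw [← hp']
  by_contra! hlt
  have hnn := nonneg_of_neg_mul_abs_le_deriv (L := L) hp (fun y hy => by
    have h1 := (abs_le.1 (hh.lipschitz y hy (p y) 0)).1
    rw [sub_zero] at h1
    linarith [hr y hy]) hlt.le
  have := intervalIntegral.integral_pos hℓ hp.continuousOn (fun y hy => hnn y ⟨hy.1.le, hy.2⟩)
    ⟨0, ⟨le_rfl, hℓ.le⟩, hlt⟩
  linarith

/-- A start p(0) ≤ 0 forces p ≤ 0, and the zero integral then forces p = 0, which does not solve the
equation. This gives the constants that are too small for any supersolution. -/
theorem zero_pos (hℓ : 0 < ℓ) (hh : IsLipschitzField ℓ L h) (hS : IsShooting ℓ h S) {r : ℝ}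
    (hr : ∀ y ∈ Icc 0 ℓ, h y 0 + r < 0) : 0 < S 0 r := by
  obtain ⟨p, hp, hp', hi⟩ := hS.exists_solution 0 r
  rw [← hp']
  by_contra! hle
  have hnn := nonneg_of_neg_mul_abs_le_deriv (q := fun y => -p y) (L := L)
    (fun y hy => (hp y hy).fun_neg) (fun y hy => by
      have h1 := (abs_le.1 (hh.lipschitz y hy (p y) 0)).2
      rw [sub_zero] at h1
      rw [abs_neg]
      linarith [hr y hy]) (by linarith)
  have hzero : ∀ y ∈ Icc 0 ℓ, p y = 0 := by
    by_contra! hne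
    obtain ⟨y, hy, hy0⟩ := hne
    have := intervalIntegral.integral_pos hℓ hp.continuousOn.neg
      (fun y hy => hnn y ⟨hy.1.le, hy.2⟩)
      ⟨y, hy, lt_of_le_of_ne (hnn y hy) (by simpa using Ne.symm (neg_ne_zero.2 hy0))⟩
    simp [hi] at this
  have h0 : (0 : ℝ) ∈ Icc 0 ℓ := ⟨le_rfl, hℓ.le⟩
  have h1 := (hp 0 h0).congr (f₁ := fun _ => (0 : ℝ)) (fun y hy => (hzero y hy).symm)
    (hzero 0 h0).symm
  have h2 := (uniqueDiffOn_Icc hℓ 0 h0).eq_deriv _ h1 (hasDerivWithinAt_const 0 (Icc 0 ℓ) (0 : ℝ))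
  rw [hzero 0 h0] at h2
  linarith [hr 0 h0]

/-- The final value of a solution, through the reversed edge. -/
theorem final_eq (hS : IsShooting ℓ (fun y p => h (ℓ - y) (-p)) S) {r : ℝ} {p : ℝ → ℝ}
    (hp : IsEdgeSolution ℓ h r p) : -p ℓ = S (-∫ y in (0 : ℝ)..ℓ, p y) r := by
  have := hS.initial_eq r _ hp.reverse
  simpa using this

end IsShooting

end Shooting

/-! ### Monotone nodal systems on a finite connected graph. -/

section NodalSystem

/-- The data of a monotone nodal system on a finite graph: `Φ i α e r` is the flux through the
vertex `i` along the edge `α`, whose other endpoint is `o i α`, when the node values differ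
by `e`. -/
structure IsNodalSystem {I A : Type*} (E : I → Finset A) (o : I → A → I)
    (w : I → A → ℝ) (Φ : I → A → ℝ → ℝ → ℝ) : Prop where
  connected : ∀ S : Set I, S.Nonempty → (∀ i ∈ S, ∀ α ∈ E i, o i α ∈ S) → S = univ
  nonempty : ∀ i, (E i).Nonempty
  pos : ∀ i, ∀ α ∈ E i, 0 < w i α
  continuous : ∀ i, ∀ α ∈ E i, Continuous fun z : ℝ × ℝ => Φ i α z.1 z.2
  strictMono : ∀ i, ∀ α ∈ E i, ∀ r, StrictMono fun e => Φ i α e r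
  mono : ∀ i, ∀ α ∈ E i, ∀ e, Monotone fun r => Φ i α e r
  unbounded : ∀ i, ∀ α ∈ E i, ∀ r M, ∃ e, Φ i α e r ≤ M
  exists_nonneg : ∃ r, ∀ i, ∀ α ∈ E i, 0 ≤ Φ i α 0 r
  exists_neg : ∃ r, ∀ i, ∀ α ∈ E i, Φ i α 0 r < 0

namespace IsNodalSystem

variable {I A : Type*} {E : I → Finset A} {o : I → A → I}
  {w : I → A → ℝ} {Φ : I → A → ℝ → ℝ → ℝ}

variable (E o w Φ) in
/-- The total flux through a vertex. -/
def flux (V : I → ℝ) (r : ℝ) (i : I) : ℝ := ∑ α ∈ E i, w i α * Φ i α (V i - V (o i α)) r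

theorem continuous_flux (hΦ : IsNodalSystem E o w Φ) (i : I) :
    Continuous fun z : (I → ℝ) × ℝ => flux E o w Φ z.1 z.2 i := by
  refine continuous_finsetSum _ fun α hα => continuous_const.mul ?_
  exact (hΦ.continuous i α hα).comp (by fun_prop :
    Continuous fun z : (I → ℝ) × ℝ => (z.1 i - z.1 (o i α), z.2))

theorem flux_sub_const (V : I → ℝ) (c r : ℝ) (i : I) :
    flux E o w Φ (fun j => V j - c) r i = flux E o w Φ V r i := by
  simp [flux]

variable [Fintype I]

/-- The node values of a supersolution are bounded above in terms of their minimum. -/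
theorem exists_bound (hΦ : IsNodalSystem E o w Φ) (r₁ : ℝ) :
    ∃ b, ∀ V r, r ≤ r₁ → (∀ i, 0 ≤ flux E o w Φ V r i) → (∀ i, 0 ≤ V i) → (∃ i, V i = 0) →
      ∀ j, V j ≤ b := by
  have key : ∀ i₀ j, ∃ b, ∀ V r, r ≤ r₁ → (∀ i, 0 ≤ flux E o w Φ V r i) → (∀ i, 0 ≤ V i) →
      V i₀ = 0 → V j ≤ b := by
    intro i₀
    suffices h : {j | ∃ b, ∀ V r, r ≤ r₁ → (∀ i, 0 ≤ flux E o w Φ V r i) → (∀ i, 0 ≤ V i) →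
      V i₀ = 0 → V j ≤ b} = univ from fun j =>
        h.ge (mem_univ j)
    refine hΦ.connected _ ⟨i₀, 0, fun V r _ _ _ h => h.le⟩ ?_
    rintro j ⟨b, hb⟩ α hα
    -- Since V j ≤ b and V ≥ 0, all differences at j are at most b, so M dominates the flux through
    -- the other edges. The value e below is so low that a neighbour above b - e would make the
    -- total flux at j negative.
    set M := ∑ β ∈ E j, w j β * |Φ j β b r₁| with hM
    obtain ⟨e, he⟩ := hΦ.unbounded j α hα r₁ (-(M + 1) / w j α)
    refine ⟨b - e, fun V r hr hF hV hV0 => ?_⟩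
    have hVb := hb V r hr hF hV hV0
    have hw := hΦ.pos j α hα
    by_contra! hlt
    have h1 : w j α * Φ j α (V j - V (o j α)) r ≤ -(M + 1) := by
      have h2 : Φ j α (V j - V (o j α)) r ≤ -(M + 1) / w j α := by
        refine le_trans ?_ he
        exact ((hΦ.strictMono j α hα r).monotone (by linarith)).trans (hΦ.mono j α hα e hr)
      have := mul_le_mul_of_nonneg_left h2 hw.le
      rwa [mul_div_cancel₀ _ hw.ne'] at this
    have h3 : ∀ β ∈ E j, w j β * Φ j β (V j - V (o j β)) r ≤ w j β * |Φ j β b r₁| := by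
      intro β hβ
      refine mul_le_mul_of_nonneg_left (le_trans ?_ (le_abs_self _)) (hΦ.pos j β hβ).le
      exact ((hΦ.strictMono j β hβ r).monotone (by linarith [hV (o j β)])).trans
        (hΦ.mono j β hβ b hr)
    have h4 := hF j
    classical
    rw [flux, ← Finset.add_sum_erase _ _ hα] at h4
    have h5 : ∑ β ∈ (E j).erase α, w j β * Φ j β (V j - V (o j β)) r ≤ M := by
      refine (Finset.sum_le_sum fun β hβ => h3 β (Finset.mem_of_mem_erase hβ)).trans ?_
      exact Finset.sum_le_sum_of_subset_of_nonneg (Finset.erase_subset _ _)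
        fun β hβ _ => mul_nonneg (hΦ.pos j β hβ).le (abs_nonneg _)
    linarith
  choose b hb using key
  refine ⟨∑ i, ∑ j, |b i j|, fun V r hr hF hV ⟨i, hi⟩ j => (hb i j V r hr hF hV hi).trans ?_⟩
  refine (le_abs_self _).trans ?_
  refine (Finset.single_le_sum (f := fun j => |b i j|) (fun _ _ => abs_nonneg _)
    (Finset.mem_univ j)).trans ?_
  exact Finset.single_le_sum (f := fun i => ∑ j, |b i j|)
    (fun _ _ => Finset.sum_nonneg fun _ _ => abs_nonneg _) (Finset.mem_univ i)

/-- A supersolution can be normalized to have minimum `0`. -/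
theorem exists_normalized [Nonempty I] (V : I → ℝ) :
    ∃ c, (∀ i, 0 ≤ V i - c) ∧ ∃ i, V i - c = 0 := by
  obtain ⟨i, hi⟩ := Finite.exists_min V
  exact ⟨V i, fun j => sub_nonneg.2 (hi j), i, sub_self _⟩

/-- At a vertex of minimal value all differences are nonpositive, so for r ≤ r₀ the flux there would
be negative. This bounds the admissible constants from below. -/
theorem lt_of_flux_nonneg [Nonempty I] (hΦ : IsNodalSystem E o w Φ) {r₀ r : ℝ}
    (hr₀ : ∀ i, ∀ α ∈ E i, Φ i α 0 r₀ < 0) {V : I → ℝ} (hF : ∀ i, 0 ≤ flux E o w Φ V r i) :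
    r₀ < r := by
  by_contra! hle
  obtain ⟨i, hi⟩ := Finite.exists_min V
  have : flux E o w Φ V r i < 0 := by
    refine Finset.sum_neg (fun α hα => mul_neg_of_pos_of_neg (hΦ.pos i α hα) ?_) (hΦ.nonempty i)
    refine lt_of_le_of_lt ?_ (hr₀ i α hα)
    exact ((hΦ.strictMono i α hα r).monotone (by linarith [hi (o i α)])).trans
      (hΦ.mono i α hα 0 hle)
  linarith [hF i]

/-- There is a smallest constant that admits a supersolution. -/
theorem exists_minimal [Nonempty I] (hΦ : IsNodalSystem E o w Φ) :
    ∃ V r, (∀ i, 0 ≤ flux E o w Φ V r i) ∧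
      ∀ V' r', (∀ i, 0 ≤ flux E o w Φ V' r' i) → r ≤ r' := by
  obtain ⟨r₁, hr₁⟩ := hΦ.exists_nonneg
  obtain ⟨r₀, hr₀⟩ := hΦ.exists_neg
  obtain ⟨b, hb⟩ := hΦ.exists_bound r₁
  have h01 : ∀ i, 0 ≤ flux E o w Φ 0 r₁ i := by
    intro i
    refine Finset.sum_nonneg fun α hα => mul_nonneg (hΦ.pos i α hα).le ?_
    simpa using hr₁ i α hα
  -- Every supersolution with constant at most r₁ can be shifted into this compact set, since fluxes
  -- depend only on differences.
  set K : Set ((I → ℝ) × ℝ) := (Icc 0 (fun _ => b) ×ˢ Icc r₀ r₁) ∩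
    ⋂ i, {z | 0 ≤ flux E o w Φ z.1 z.2 i} with hK
  have hKc : IsCompact K := (isCompact_Icc.prod isCompact_Icc).inter_right
    (isClosed_iInter fun i => isClosed_le continuous_const (hΦ.continuous_flux i))
  have hmem : ∀ V r, r ≤ r₁ → (∀ i, 0 ≤ flux E o w Φ V r i) → ∃ V', (V', r) ∈ K := by
    intro V r hr hF
    obtain ⟨c, hc, hc'⟩ := exists_normalized V
    have hF' : ∀ i, 0 ≤ flux E o w Φ (fun j => V j - c) r i := fun i => by
      rw [flux_sub_const]; exact hF i
    exact ⟨fun j => V j - c, ⟨⟨hc, hb _ r hr hF' hc hc'⟩, (hΦ.lt_of_flux_nonneg hr₀ hF).le, hr⟩,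
      mem_iInter.2 hF'⟩
  obtain ⟨V₁, hV₁⟩ := hmem 0 r₁ le_rfl h01
  obtain ⟨z, hz, hmin⟩ := hKc.exists_isMinOn ⟨_, hV₁⟩ continuous_snd.continuousOn
  refine ⟨z.1, z.2, mem_iInter.1 hz.2, fun V' r' hF => ?_⟩
  rcases le_total r' r₁ with h | h
  · obtain ⟨V'', hV''⟩ := hmem V' r' h hF
    exact hmin hV''
  · exact hz.1.2.2.trans h

/-- A connected monotone nodal system has a solution. -/
theorem exists_solution [Nonempty I] (hΦ : IsNodalSystem E o w Φ) :
    ∃ V r, ∀ i, flux E o w Φ V r i = 0 := by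
  classical
  obtain ⟨V₀, r, hV₀, hr⟩ := hΦ.exists_minimal
  let T : Set (I → ℝ) := {V | ∀ i, 0 ≤ flux E o w Φ V r i}
  let Z : (I → ℝ) → Finset I := fun V => Finset.univ.filter fun i => flux E o w Φ V r i = 0
  -- Among the supersolutions for the minimal r, take one with the fewest vertices of zero flux.
  obtain ⟨V, hVT, hVmin⟩ := (measure fun V => (Z V).card).wf.has_min T ⟨V₀, hV₀⟩
  refine ⟨V, r, ?_⟩
  by_contra hne
  have hZ : ∀ i, i ∈ Z V ↔ flux E o w Φ V r i = 0 := by simp [Z]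
  have hpos : ∀ i, i ∉ Z V → 0 < flux E o w Φ V r i := fun i hi =>
    lt_of_le_of_ne (hVT i) fun h => hi ((hZ i).2 h.symm)
  rcases (Z V).eq_empty_or_nonempty with h0 | h0
  -- All fluxes are positive here, so by continuity a smaller constant would still do.
  · have hev : ∀ᶠ s in 𝓝 r, ∀ i, 0 < flux E o w Φ V s i := by
      rw [eventually_all]
      intro i
      have hc : Continuous fun s => flux E o w Φ V s i :=
        (hΦ.continuous_flux i).comp (by fun_prop : Continuous fun s : ℝ => (V, s))
      exact hc.continuousAt.eventually_const_lt (hpos i (by simp [h0]))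
    obtain ⟨s, hs, hsr⟩ := ((hev.filter_mono nhdsWithin_le_nhds).and
      (self_mem_nhdsWithin (s := Iio r))).exists
    exact absurd (hr V s fun i => (hs i).le) (not_le.2 hsr)
  · have hnotall : (Z V : Set I) ≠ univ := by
      intro h
      apply hne
      intro i
      rw [← hZ, ← Finset.mem_coe, h]
      trivial
    have : ∃ i ∈ Z V, ∃ α ∈ E i, o i α ∉ Z V := by
      by_contra! h
      exact hnotall (hΦ.connected _ (by simpa using h0) (by simpa using h))
    obtain ⟨i, hi, α, hα, hoα⟩ := this
    -- Raising V on its zero-flux set lowers no difference seen from that set and strictly raises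
    -- the one across α. Elsewhere positivity survives for small ε, so W has fewer zero-flux
    -- vertices.
    let W : ℝ → I → ℝ := fun ε j => V j + if j ∈ Z V then ε else 0
    have hW0 : W 0 = V := by ext j; simp [W]
    have hWc : Continuous W := by
      refine continuous_pi fun j => ?_
      by_cases hj : j ∈ Z V <;> simp only [W, hj, if_true, if_false] <;> fun_prop
    have hev : ∀ᶠ ε in 𝓝 (0 : ℝ), ∀ j, j ∉ Z V → 0 < flux E o w Φ (W ε) r j := by
      rw [eventually_all]
      intro j
      by_cases hj : j ∈ Z V
      · simp [hj]
      have hc : Continuous fun ε => flux E o w Φ (W ε) r j :=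
        (hΦ.continuous_flux j).comp (by fun_prop : Continuous fun ε : ℝ => (W ε, r))
      have h0 : 0 < flux E o w Φ (W 0) r j := by rw [hW0]; exact hpos j hj
      exact (hc.continuousAt.eventually_const_lt h0).mono fun ε hε _ => hε
    obtain ⟨ε, hε, hε0⟩ := ((hev.filter_mono nhdsWithin_le_nhds).and
      (self_mem_nhdsWithin (s := Ioi (0 : ℝ)))).exists
    have hle : ∀ j ∈ Z V, ∀ β, V j - V (o j β) ≤ W ε j - W ε (o j β) := by
      intro j hj β
      simp only [W, hj, if_true]
      split_ifs <;> linarith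
    have hterm : ∀ j ∈ Z V, ∀ β ∈ E j, w j β * Φ j β (V j - V (o j β)) r ≤
        w j β * Φ j β (W ε j - W ε (o j β)) r := fun j hj β hβ =>
      mul_le_mul_of_nonneg_left ((hΦ.strictMono j β hβ r).monotone (hle j hj β))
        (hΦ.pos j β hβ).le
    have hWT : W ε ∈ T := by
      intro j
      by_cases hj : j ∈ Z V
      · exact (hVT j).trans (Finset.sum_le_sum (hterm j hj))
      · exact (hε j hj).le
    have hWi : 0 < flux E o w Φ (W ε) r i := by
      refine lt_of_le_of_lt (hVT i) (Finset.sum_lt_sum (hterm i hi) ⟨α, hα, ?_⟩)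
      refine mul_lt_mul_of_pos_left (hΦ.strictMono i α hα r ?_) (hΦ.pos i α hα)
      simp only [W, hi, hoα, if_true, if_false]
      linarith
    refine hVmin (W ε) hWT (Finset.card_lt_card ?_)
    refine Finset.ssubset_iff_subset_ne.2 ⟨fun j hj => ?_, fun h => ?_⟩
    · by_contra hj'
      have h1 := hε j hj'
      simp only [Z, Finset.mem_filter, Finset.mem_univ, true_and] at hj
      exact h1.ne' hj
    · rw [← h] at hi
      simp only [Z, Finset.mem_filter, Finset.mem_univ, true_and] at hi
      exact hWi.ne' hi

end IsNodalSystem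

end NodalSystem

/-! ### Topology of the network: combinatorial connectedness and gluing along edges. -/

namespace Network

variable {n : ℕ} {I A : Type*} [Fintype I] [Fintype A] (N : Network n I A)

theorem mem_inc {i : I} {α : A} : α ∈ N.inc i ↔ i = N.src α ∨ i = N.tgt α := by
  classical
  simp only [inc, Finset.mem_filter, Finset.mem_univ, true_and]
  refine ⟨N.vertex_mem_edge i α, ?_⟩
  rintro (rfl | rfl)
  exacts [left_mem_segment _ _ _, right_mem_segment _ _ _]

theorem src_mem_inc (α : A) : α ∈ N.inc (N.src α) := N.mem_inc.2 (Or.inl rfl)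

theorem tgt_mem_inc (α : A) : α ∈ N.inc (N.tgt α) := N.mem_inc.2 (Or.inr rfl)

theorem inc_nonempty (i : I) : (N.inc i).Nonempty :=
  let ⟨α, hα⟩ := N.vertex_endpoint i
  ⟨α, N.mem_inc.2 hα⟩

theorem nonempty_edges (N : Network n I A) : Nonempty A := by
  obtain ⟨x, hx⟩ := N.connected.nonempty
  exact ⟨(mem_iUnion.1 hx).choose⟩

theorem nonempty_vertices (N : Network n I A) : Nonempty I := N.nonempty_edges.map N.src

theorem isClosed_edge (α : A) : IsClosed (N.edge α) := by
  rw [edge, segment_eq_image_lineMap]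
  exact (isCompact_Icc.image AffineMap.lineMap_continuous).isClosed

/-- Passage from topological to combinatorial connectedness. The edges with source in S and the
others have closed unions covering Γ. If both were nonempty they would meet, and two different edges
meet only at a common vertex, which would lie both in S and outside it. -/
theorem eq_univ_of_src_mem_iff_tgt_mem {S : Set I} (hS : S.Nonempty)
    (h : ∀ α, N.src α ∈ S ↔ N.tgt α ∈ S) : S = univ := by
  have hedge : ∀ i, ∃ α, N.vertex i ∈ N.edge α ∧ (i ∈ S ↔ N.src α ∈ S) := by
    intro i
    obtain ⟨α, rfl | rfl⟩ := N.vertex_endpoint i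
    · exact ⟨α, left_mem_segment _ _ _, Iff.rfl⟩
    · exact ⟨α, right_mem_segment _ _ _, (h α).symm⟩
  by_contra hne
  obtain ⟨j, hj⟩ := (ne_univ_iff_exists_notMem S).1 hne
  obtain ⟨i, hi⟩ := hS
  have hclosed : ∀ T : Set A, IsClosed (⋃ α ∈ T, N.edge α) := fun T =>
    T.toFinite.isClosed_biUnion fun α _ => N.isClosed_edge α
  have hsub : ∀ T : Set A, (⋃ α ∈ T, N.edge α) ⊆ N.carrier := fun T =>
    iUnion₂_subset fun α _ => subset_iUnion N.edge α
  obtain ⟨α, hα, hα'⟩ := hedge i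
  obtain ⟨β, hβ, hβ'⟩ := hedge j
  have h1 := mem_biUnion (show α ∈ {α | N.src α ∈ S} from hα'.1 hi) hα
  have h2 := mem_biUnion (show β ∈ {α | N.src α ∉ S} from fun hb => hj (hβ'.2 hb)) hβ
  obtain ⟨x, -, hx1, hx2⟩ := isPreconnected_closed_iff.1 N.connected.isPreconnected
    (⋃ α ∈ {α | N.src α ∈ S}, N.edge α) (⋃ α ∈ {α | N.src α ∉ S}, N.edge α) (hclosed _) (hclosed _)
    (fun x hx => by
      obtain ⟨γ, hγ⟩ := mem_iUnion.1 hx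
      by_cases hS : N.src γ ∈ S
      · exact Or.inl (mem_biUnion (show γ ∈ {α | N.src α ∈ S} from hS) hγ)
      · exact Or.inr (mem_biUnion (show γ ∈ {α | N.src α ∉ S} from hS) hγ))
    ⟨_, hsub _ h1, h1⟩ ⟨_, hsub _ h2, h2⟩
  simp only [mem_iUnion, mem_ofPred_eq, exists_prop] at hx1 hx2
  obtain ⟨α, hα, hxα⟩ := hx1
  obtain ⟨β, hβ, hxβ⟩ := hx2
  have hαβ : α ≠ β := by rintro rfl; exact hβ hα
  rcases N.inter_edges α β hαβ with h0 | ⟨k, hk⟩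
  · exact (h0 ▸ ⟨hxα, hxβ⟩ : x ∈ (∅ : Set _))
  · have hkm := hk.ge (mem_singleton (N.vertex k))
    have hkα : k ∈ S := by
      rcases N.vertex_mem_edge k α hkm.1 with rfl | rfl
      exacts [hα, (h α).1 hα]
    rcases N.vertex_mem_edge k β hkm.2 with rfl | rfl
    exacts [hβ hkα, hβ ((h β).2 hkα)]

open Classical in
/-- The endpoint of the edge `α` other than `i`. -/
noncomputable def otherEnd (i : I) (α : A) : I := if i = N.src α then N.tgt α else N.src α

theorem eq_univ_of_otherEnd_mem {S : Set I} (hS : S.Nonempty)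
    (h : ∀ i ∈ S, ∀ α ∈ N.inc i, N.otherEnd i α ∈ S) : S = univ := by
  refine N.eq_univ_of_src_mem_iff_tgt_mem hS fun α => ⟨fun hα => ?_, fun hα => ?_⟩
  · simpa [otherEnd] using h _ hα α (N.src_mem_inc α)
  · simpa [otherEnd, (N.src_ne_tgt α).symm] using h _ hα α (N.tgt_mem_inc α)

theorem zero_mem (α : A) : (0 : ℝ) ∈ Icc 0 (N.len α) := ⟨le_rfl, (N.len_pos α).le⟩

theorem len_mem (α : A) : N.len α ∈ Icc 0 (N.len α) := ⟨(N.len_pos α).le, le_rfl⟩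

theorem continuous_param (α : A) : Continuous (N.param α) := by
  refine Continuous.subtype_mk ?_ _
  exact AffineMap.lineMap_continuous.comp (continuous_subtype_val.div_const _)

theorem exists_param_eq (x : N.carrier) : ∃ α y, N.param α y = x := by
  obtain ⟨α, hα⟩ := mem_iUnion.1 x.2
  rw [edge, segment_eq_image_lineMap] at hα
  obtain ⟨t, ht, hx⟩ := hα
  have hl := N.len_pos α
  refine ⟨α, ⟨t * N.len α, mul_nonneg ht.1 hl.le, mul_le_of_le_one_left hl.le ht.2⟩, ?_⟩
  apply Subtype.ext
  simp only [param]
  rw [mul_div_cancel_right₀ _ hl.ne', hx]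

theorem param_mem_edge (α : A) (y : Icc (0 : ℝ) (N.len α)) : (N.param α y : EuclideanSpace ℝ (Fin n)) ∈ N.edge α := by
  rw [edge, segment_eq_image_lineMap]
  exact ⟨_, ⟨div_nonneg y.2.1 (N.len_pos α).le, (div_le_one (N.len_pos α)).2 y.2.2⟩, rfl⟩

theorem param_zero (α : A) : (N.param α ⟨0, N.zero_mem α⟩ : EuclideanSpace ℝ (Fin n)) =
    N.vertex (N.src α) := by
  simp [param]

theorem param_len (α : A) : (N.param α ⟨N.len α, N.len_mem α⟩ : EuclideanSpace ℝ (Fin n)) =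
    N.vertex (N.tgt α) := by
  simp [param, div_self (N.len_pos α).ne']

theorem param_injective (α : A) : Function.Injective (N.param α) := by
  intro y z h
  have h1 := congrArg Subtype.val h
  simp only [param] at h1
  have h2 := AffineMap.lineMap_injective ℝ
    (fun h => N.src_ne_tgt α (N.vertex_injective h)) h1
  exact Subtype.ext ((div_left_inj' (N.len_pos α).ne').1 h2)

/-- Functions on the edges that agree at the vertices come from a continuous function on `Γ`. -/
theorem exists_continuous_glue {u : A → ℝ → ℝ} {V : I → ℝ}
    (hc : ∀ α, ContinuousOn (u α) (Icc 0 (N.len α))) (h0 : ∀ α, u α 0 = V (N.src α))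
    (hl : ∀ α, u α (N.len α) = V (N.tgt α)) :
    ∃ v : N.carrier → ℝ, Continuous v ∧ ∀ α y, v (N.param α y) = u α y := by
  have hvert : ∀ α (y : Icc (0 : ℝ) (N.len α)) i,
      (N.param α y : EuclideanSpace ℝ (Fin n)) = N.vertex i → u α y = V i := by
    intro α y i hi
    rcases N.vertex_mem_edge i α (hi ▸ N.param_mem_edge α y) with rfl | rfl
    · rw [← N.param_zero α] at hi
      rw [N.param_injective α (Subtype.ext hi)]
      exact h0 α
    · rw [← N.param_len α] at hi
      rw [N.param_injective α (Subtype.ext hi)]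
      exact hl α
  have hwd : ∀ α β (y : Icc (0 : ℝ) (N.len α)) (z : Icc (0 : ℝ) (N.len β)),
      N.param α y = N.param β z → u α y = u β z := by
    intro α β y z h
    by_cases hαβ : α = β
    · subst hαβ
      rw [N.param_injective α h]
    · have hmem : (N.param α y : EuclideanSpace ℝ (Fin n)) ∈ N.edge α ∩ N.edge β :=
        ⟨N.param_mem_edge α y, h ▸ N.param_mem_edge β z⟩
      rcases N.inter_edges α β hαβ with he | ⟨i, hi⟩
      · exact absurd hmem (by rw [edge, edge, he]; exact notMem_empty _)
      · have hy : (N.param α y : EuclideanSpace ℝ (Fin n)) = N.vertex i := by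
          rw [edge, edge, hi] at hmem
          exact hmem
        rw [hvert α y i hy, hvert β z i (h ▸ hy)]
  choose a b hab using N.exists_param_eq
  let v : N.carrier → ℝ := fun x => u (a x) (b x)
  have hv : ∀ α y, v (N.param α y) = u α y := fun α y => hwd _ _ _ _ (hab _)
  refine ⟨v, ?_, hv⟩
  -- A continuous surjection from a compact space to a Hausdorff space is a quotient map, so
  -- continuity on Γ can be tested edge by edge.
  let π : (Σ α, Icc (0 : ℝ) (N.len α)) → N.carrier := fun x => N.param x.1 x.2
  have hπ : IsQuotientMap π := by
    refine IsQuotientMap.of_surjective_continuous (fun x => ?_)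
      (continuous_sigma fun α => N.continuous_param α)
    obtain ⟨α, y, h⟩ := N.exists_param_eq x
    exact ⟨⟨α, y⟩, h⟩
  rw [hπ.continuous_iff]
  refine continuous_sigma fun α => ?_
  have : (v ∘ π) ∘ Sigma.mk α = fun y : Icc (0 : ℝ) (N.len α) => u α y := funext fun y => hv α y
  change Continuous ((v ∘ π) ∘ Sigma.mk α)
  rw [this]
  exact continuousOn_iff_continuous_domRestrict.1 (hc α)

theorem onEdge_eq_of_continuous {v : N.carrier → ℝ} (hv : Continuous v) {α : A} {y : ℝ}
    (hy : y ∈ Icc 0 (N.len α)) : N.onEdge v α y = v (N.param α ⟨y, hy⟩) := by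
  have hp : N.pullback v α y = v (N.param α ⟨y, hy⟩) :=
    IccExtend_of_mem _ _ hy
  rw [onEdge]
  split_ifs with h
  · exact hp
  · have hc : Continuous (N.pullback v α) :=
      (hv.comp (N.continuous_param α)).Icc_extend'
    rw [← hp]
    have : (𝓝[Ioo 0 (N.len α)] y).NeBot := by
      rw [← mem_closure_iff_nhdsWithin_neBot, closure_Ioo (N.len_pos α).ne]
      exact hy
    exact (hc.tendsto y |>.mono_left nhdsWithin_le_nhds).limUnder_eq

/-- A bound for the differences of the node values in terms of the slopes along the edges. -/
theorem exists_vertex_bound : ∃ D : ℝ, 0 ≤ D ∧ ∀ (V : I → ℝ) (P : ℝ), 0 ≤ P →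
    (∀ α, |V (N.tgt α) - V (N.src α)| ≤ P * N.len α) → ∀ i j, |V i - V j| ≤ P * D := by
  have key : ∀ i j, ∃ D : ℝ, ∀ (V : I → ℝ) (P : ℝ), 0 ≤ P →
      (∀ α, |V (N.tgt α) - V (N.src α)| ≤ P * N.len α) → |V i - V j| ≤ P * D := by
    intro i
    suffices h : {j | ∃ D : ℝ, ∀ (V : I → ℝ) (P : ℝ), 0 ≤ P →
      (∀ α, |V (N.tgt α) - V (N.src α)| ≤ P * N.len α) → |V i - V j| ≤ P * D} = univ from
      fun j => h.ge (mem_univ j)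
    refine N.eq_univ_of_src_mem_iff_tgt_mem ⟨i, 0, fun V P _ _ => by simp⟩ fun α => ⟨?_, ?_⟩
    · rintro ⟨D, hD⟩
      refine ⟨D + N.len α, fun V P hP h => ?_⟩
      have h1 := hD V P hP h
      have h2 := h α
      rw [abs_sub_comm] at h2
      have := abs_sub_le (V i) (V (N.src α)) (V (N.tgt α))
      linarith
    · rintro ⟨D, hD⟩
      refine ⟨D + N.len α, fun V P hP h => ?_⟩
      have h1 := hD V P hP h
      have h2 := h α
      have := abs_sub_le (V i) (V (N.tgt α)) (V (N.src α))
      linarith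
  choose D hD using key
  have hnn : ∀ i, 0 ≤ ∑ j, |D i j| := fun i => Finset.sum_nonneg fun _ _ => abs_nonneg _
  refine ⟨∑ i, ∑ j, |D i j|, Finset.sum_nonneg fun i _ => hnn i, fun V P hP h i j =>
    (hD i j V P hP h).trans (mul_le_mul_of_nonneg_left ?_ hP)⟩
  refine (le_abs_self _).trans ?_
  refine (Finset.single_le_sum (f := fun j => |D i j|) (fun _ _ => abs_nonneg _)
    (Finset.mem_univ j)).trans ?_
  exact Finset.single_le_sum (f := fun i => ∑ j, |D i j|) (fun i _ => hnn i) (Finset.mem_univ i)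

end Network

/-! ### One-sided calculus at maxima, and uniqueness for linear differential inequalities. -/

section Calculus

/-- Taking z on either side of y covers both cases: a vanishing derivative in the interior, a sign
at an endpoint. -/
theorem mul_sub_nonpos_of_isMax {f : ℝ → ℝ} {f' a b y z : ℝ} (hf : HasDerivWithinAt f f' (Icc a b) y)
    (hy : y ∈ Icc a b) (hz : z ∈ Icc a b) (hmax : ∀ x ∈ Icc a b, f x ≤ f y) :
    f' * (z - y) ≤ 0 := by
  have h1 : IsLocalMaxOn f (Icc a b) y := eventually_nhdsWithin_of_forall hmax
  have h2 := h1.hasFDerivWithinAt_nonpos hf.hasFDerivWithinAt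
    (sub_mem_posTangentConeAt_of_segment_subset ((convex_Icc a b).segment_subset hy hz))
  simpa [mul_comm] using h2

/-- A function is larger somewhere near a critical point with positive second derivative. -/
theorem exists_gt_of_second_deriv_pos {u p : ℝ → ℝ} {a b y d : ℝ} (hab : a < b) (hy : y ∈ Icc a b)
    (hu : ∀ z ∈ Icc a b, HasDerivWithinAt u (p z) (Icc a b) z)
    (hp : HasDerivWithinAt p d (Icc a b) y) (hp0 : p y = 0) (hd : 0 < d) :
    ∃ z ∈ Icc a b, u y < u z := by
  -- Near y, p has the sign of z - y, so u increases away from y on whichever side the interval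
  -- offers.
  have h1 := (hasDerivWithinAt_iff_tendsto_slope.1 hp).eventually (lt_mem_nhds hd)
  obtain ⟨δ, hδ, h2⟩ := Metric.eventually_nhds_iff.1 (eventually_nhdsWithin_iff.1 h1)
  have hsign : ∀ z ∈ Icc a b, z ≠ y → |z - y| < δ → 0 < (z - y)⁻¹ * p z := by
    intro z hz hzy hlt
    have := h2 (y := z) (by rwa [Real.dist_eq]) ⟨hz, hzy⟩
    rwa [slope_def_field, hp0, sub_zero, div_eq_inv_mul] at this
  have hsub : ∀ x z, Icc x z ⊆ Icc a b → ContinuousOn u (Icc x z) ∧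
      ∀ c ∈ interior (Icc x z), HasDerivWithinAt u (p c) (interior (Icc x z)) c := fun x z h =>
    ⟨(continuousOn_of_forall_hasDerivWithinAt hu).mono h, fun c hc =>
      (hu c (h (interior_subset hc))).mono (interior_subset.trans h)⟩
  rcases lt_or_ge y b with hyb | hyb
  · have hz0 : y < min b (y + δ / 2) := lt_min hyb (by linarith)
    have hss : Icc y (min b (y + δ / 2)) ⊆ Icc a b := Icc_subset_Icc hy.1 (min_le_left _ _)
    refine ⟨min b (y + δ / 2), ⟨hy.1.trans hz0.le, min_le_left _ _⟩, ?_⟩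
    obtain ⟨hc, hd'⟩ := hsub _ _ hss
    refine strictMonoOn_of_hasDerivWithinAt_pos (convex_Icc _ _) hc hd' (fun c hc => ?_)
      (left_mem_Icc.2 hz0.le) (right_mem_Icc.2 hz0.le) hz0
    have hcm := hss (interior_subset hc)
    rw [interior_Icc] at hc
    have h3 := hc.2.trans_le (min_le_right _ _)
    have h4 := hsign c hcm hc.1.ne' (by rw [abs_of_pos (by linarith [hc.1])]; linarith)
    exact (pos_iff_pos_of_mul_pos h4).1 (inv_pos.2 (by linarith [hc.1]))
  · have hyb' : y = b := le_antisymm hy.2 hyb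
    have hz0 : max a (y - δ / 2) < y := max_lt (by linarith) (by linarith)
    have hss : Icc (max a (y - δ / 2)) y ⊆ Icc a b := Icc_subset_Icc (le_max_left _ _) hy.2
    refine ⟨max a (y - δ / 2), ⟨le_max_left _ _, hz0.le.trans hy.2⟩, ?_⟩
    obtain ⟨hc, hd'⟩ := hsub _ _ hss
    refine strictAntiOn_of_hasDerivWithinAt_neg (convex_Icc _ _) hc hd' (fun c hc => ?_)
      (left_mem_Icc.2 hz0.le) (right_mem_Icc.2 hz0.le) hz0
    have hcm := hss (interior_subset hc)
    rw [interior_Icc] at hc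
    have h3 := (le_max_right _ _).trans_lt hc.1
    have h4 := hsign c hcm hc.2.ne (by rw [abs_of_neg (by linarith [hc.2])]; linarith)
    exact (neg_iff_neg_of_mul_pos h4).1 (inv_lt_zero.2 (by linarith [hc.2]))

/-- A solution of `|q'| ≤ K |q|` that vanishes somewhere vanishes identically. -/
theorem eq_zero_of_abs_deriv_le_mul_abs {q q' : ℝ → ℝ} {a b K y₀ : ℝ} (hy₀ : y₀ ∈ Icc a b)
    (hq : ∀ y ∈ Icc a b, HasDerivWithinAt q (q' y) (Icc a b) y)
    (hK : ∀ y ∈ Icc a b, |q' y| ≤ K * |q y|) (h0 : q y₀ = 0) : ∀ y ∈ Icc a b, q y = 0 := by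
  have hc := continuousOn_of_forall_hasDerivWithinAt hq
  intro y hy
  rcases le_total y₀ y with h | h
  · have hss : Icc y₀ b ⊆ Icc a b := Icc_subset_Icc_left hy₀.1
    exact eq_zero_of_abs_deriv_le_mul_abs_self_of_eq_zero_right (hc.mono hss)
      (fun x hx => hasDerivWithinAt_Ici_of_Icc hx
        ((hq x (hss (Ico_subset_Icc_self hx))).mono hss)) h0
      (fun x hx => hK x (hss (Ico_subset_Icc_self hx))) y ⟨h, hy.2⟩
  · have hm : MapsTo (fun x : ℝ => -x) (Icc (-y₀) (-a)) (Icc a b) := fun x hx =>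
      ⟨by linarith [hx.2], by linarith [hx.1, hy₀.2]⟩
    have hd : ∀ x ∈ Icc (-y₀) (-a),
        HasDerivWithinAt (fun x => q (-x)) (q' (-x) * -1) (Icc (-y₀) (-a)) x := fun x hx =>
      HasDerivWithinAt.comp x (hq (-x) (hm hx)) (hasDerivAt_neg x).hasDerivWithinAt hm
    have := eq_zero_of_abs_deriv_le_mul_abs_self_of_eq_zero_right
      (continuousOn_of_forall_hasDerivWithinAt hd)
      (fun x hx => hasDerivWithinAt_Ici_of_Icc hx (hd x (Ico_subset_Icc_self hx)))
      (K := K) (by simpa using h0)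
      (fun x hx => by simpa using hK (-x) (hm (Ico_subset_Icc_self hx))) (-y)
      ⟨by linarith, by linarith [hy.1]⟩
    simpa using this

end Calculus

/-! ### Maximum principle, uniqueness and gradient bound under Kirchhoff conditions. -/

namespace Network

variable {n : ℕ} {I A : Type*} [Fintype I] [Fintype A] (N : Network n I A)

open Classical in
/-- The outward slope at the endpoint `i` of the edge `α` of a function with derivative `p`. -/
noncomputable def outSlope (p : A → ℝ → ℝ) (i : I) (α : A) : ℝ :=
  if i = N.src α then -p α 0 else p α (N.len α)

theorem outSlope_src (p : A → ℝ → ℝ) (α : A) : N.outSlope p (N.src α) α = -p α 0 := if_pos rfl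

theorem outSlope_tgt (p : A → ℝ → ℝ) (α : A) : N.outSlope p (N.tgt α) α = p α (N.len α) :=
  if_neg (N.src_ne_tgt α).symm

/-- A twice differentiable function `u` on the network, with first and second derivatives `p` and
`dp`, that satisfies the Kirchhoff conditions with weights `w`. -/
structure IsKirchhoff (w : I → A → ℝ) (u p dp : A → ℝ → ℝ) : Prop where
  hasDeriv : ∀ α, ∀ y ∈ Icc 0 (N.len α), HasDerivWithinAt (u α) (p α y) (Icc 0 (N.len α)) y
  hasDeriv' : ∀ α, ∀ y ∈ Icc 0 (N.len α), HasDerivWithinAt (p α) (dp α y) (Icc 0 (N.len α)) y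
  glue : ∃ V : I → ℝ, ∀ α, u α 0 = V (N.src α) ∧ u α (N.len α) = V (N.tgt α)
  kirchhoff : ∀ i, ∑ α ∈ N.inc i, w i α * N.outSlope p i α = 0

namespace IsKirchhoff

variable {N} {w : I → A → ℝ} {u p dp u₁ p₁ dp₁ u₂ p₂ dp₂ : A → ℝ → ℝ}

theorem sub (h₁ : N.IsKirchhoff w u₁ p₁ dp₁) (h₂ : N.IsKirchhoff w u₂ p₂ dp₂) :
    N.IsKirchhoff w (fun α y => u₁ α y - u₂ α y) (fun α y => p₁ α y - p₂ α y)
      (fun α y => dp₁ α y - dp₂ α y) where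
  hasDeriv α y hy := (h₁.hasDeriv α y hy).sub (h₂.hasDeriv α y hy)
  hasDeriv' α y hy := (h₁.hasDeriv' α y hy).sub (h₂.hasDeriv' α y hy)
  glue := by
    obtain ⟨V₁, hV₁⟩ := h₁.glue
    obtain ⟨V₂, hV₂⟩ := h₂.glue
    exact ⟨fun i => V₁ i - V₂ i, fun α => ⟨by rw [(hV₁ α).1, (hV₂ α).1],
      by rw [(hV₁ α).2, (hV₂ α).2]⟩⟩
  kirchhoff i := by
    have : ∀ α, w i α * N.outSlope (fun α y => p₁ α y - p₂ α y) i α =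
        w i α * N.outSlope p₁ i α - w i α * N.outSlope p₂ i α := by
      intro α
      simp only [outSlope]
      split_ifs <;> ring
    simp only [this, Finset.sum_sub_distrib, h₁.kirchhoff i, h₂.kirchhoff i, sub_self]

theorem neg (h : N.IsKirchhoff w u p dp) :
    N.IsKirchhoff w (fun α y => -u α y) (fun α y => -p α y) (fun α y => -dp α y) where
  hasDeriv α y hy := (h.hasDeriv α y hy).fun_neg
  hasDeriv' α y hy := (h.hasDeriv' α y hy).fun_neg
  glue := by
    obtain ⟨V, hV⟩ := h.glue
    exact ⟨fun i => -V i, fun α => ⟨by rw [(hV α).1], by rw [(hV α).2]⟩⟩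
  kirchhoff i := by
    have : ∀ α, w i α * N.outSlope (fun α y => -p α y) i α = -(w i α * N.outSlope p i α) := by
      intro α
      simp only [outSlope]
      split_ifs <;> ring
    simp only [this, Finset.sum_neg_distrib, h.kirchhoff i, neg_zero]

theorem continuousOn (h : N.IsKirchhoff w u p dp) (α : A) :
    ContinuousOn (u α) (Icc 0 (N.len α)) := continuousOn_of_forall_hasDerivWithinAt (h.hasDeriv α)

/-- At a vertex where the maximum is attained all the slopes vanish. -/
theorem outSlope_eq_zero_of_max (h : N.IsKirchhoff w u p dp)
    (hw : ∀ i, ∀ α ∈ N.inc i, 0 < w i α) {V : I → ℝ}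
    (hV : ∀ α, u α 0 = V (N.src α) ∧ u α (N.len α) = V (N.tgt α)) {i : I}
    (hmax : ∀ α, ∀ y ∈ Icc 0 (N.len α), u α y ≤ V i) : ∀ α ∈ N.inc i, N.outSlope p i α = 0 := by
  have hnn : ∀ α ∈ N.inc i, 0 ≤ N.outSlope p i α := by
    intro α hα
    have hl := N.len_pos α
    rcases N.mem_inc.1 hα with rfl | rfl
    · have := mul_sub_nonpos_of_isMax (h.hasDeriv α 0 (N.zero_mem α)) (N.zero_mem α)
        (N.len_mem α) (fun x hx => (hmax α x hx).trans (hV α).1.ge)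
      rw [outSlope_src]
      nlinarith
    · have := mul_sub_nonpos_of_isMax (h.hasDeriv α _ (N.len_mem α)) (N.len_mem α)
        (N.zero_mem α) (fun x hx => (hmax α x hx).trans (hV α).2.ge)
      rw [outSlope_tgt]
      nlinarith
  intro α hα
  -- Nonnegative outward slopes with positive weights sum to zero, so each of them vanishes.
  have := (Finset.sum_eq_zero_iff_of_nonneg fun α hα =>
    mul_nonneg (hw i α hα).le (hnn α hα)).1 (h.kirchhoff i) α hα
  exact (mul_eq_zero.1 this).resolve_left (hw i α hα).ne'

/-- The maximum principle. -/
theorem exists_max (h : N.IsKirchhoff w u p dp) (hw : ∀ i, ∀ α ∈ N.inc i, 0 < w i α) :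
    ∃ α, ∃ y ∈ Icc 0 (N.len α), p α y = 0 ∧ dp α y ≤ 0 ∧
      ∀ β, ∀ z ∈ Icc 0 (N.len β), u β z ≤ u α y := by
  have hA := N.nonempty_edges
  choose x hx hxmax using fun α => isCompact_Icc.exists_isMaxOn ⟨0, N.zero_mem α⟩ (h.continuousOn α)
  obtain ⟨α, hα⟩ := Finite.exists_max fun α => u α (x α)
  have hmax : ∀ β, ∀ z ∈ Icc 0 (N.len β), u β z ≤ u α (x α) := fun β z hz =>
    (hxmax β hz).trans (hα β)
  -- At a vertex it is the Kirchhoff condition that makes the slope vanish. With p = 0 the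
  -- second-order test then works even from one side.
  have hp : p α (x α) = 0 := by
    obtain ⟨V, hV⟩ := h.glue
    rcases eq_or_lt_of_le (hx α).1 with h0 | h0
    · have := h.outSlope_eq_zero_of_max hw hV (i := N.src α) (by
        rw [← (hV α).1]; exact fun β z hz => h0 ▸ hmax β z hz)
        α (N.src_mem_inc α)
      rw [outSlope_src, neg_eq_zero] at this
      rwa [← h0]
    rcases eq_or_lt_of_le (hx α).2 with hl | hl
    · have := h.outSlope_eq_zero_of_max hw hV (i := N.tgt α) (by
        rw [← (hV α).2]; exact fun β z hz => hl ▸ hmax β z hz)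
        α (N.tgt_mem_inc α)
      rwa [outSlope_tgt, ← hl] at this
    · have h1 := mul_sub_nonpos_of_isMax (h.hasDeriv α _ (hx α)) (hx α) (N.len_mem α)
        (fun z hz => hmax α z hz)
      have h2 := mul_sub_nonpos_of_isMax (h.hasDeriv α _ (hx α)) (hx α) (N.zero_mem α)
        (fun z hz => hmax α z hz)
      exact le_antisymm (by nlinarith) (by nlinarith)
  refine ⟨α, x α, hx α, hp, ?_, hmax⟩
  by_contra! hd
  obtain ⟨z, hz, hlt⟩ := exists_gt_of_second_deriv_pos (N.len_pos α) (hx α) (h.hasDeriv α)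
    (h.hasDeriv' α _ (hx α)) hp hd
  exact absurd (hmax α z hz) (not_le.2 hlt)

theorem exists_min (h : N.IsKirchhoff w u p dp) (hw : ∀ i, ∀ α ∈ N.inc i, 0 < w i α) :
    ∃ α, ∃ y ∈ Icc 0 (N.len α), p α y = 0 ∧ 0 ≤ dp α y := by
  obtain ⟨α, y, hy, hp, hd, -⟩ := h.neg.exists_max hw
  exact ⟨α, y, hy, neg_eq_zero.1 hp, neg_nonpos.1 hd⟩

/-- The bound on the ergodic constant. -/
theorem abs_le {μ : A → ℝ} {h : A → ℝ → ℝ → ℝ} {ρ M : ℝ}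
    (hu : N.IsKirchhoff w u p fun α y => (h α y (p α y) + ρ) / μ α)
    (hw : ∀ i, ∀ α ∈ N.inc i, 0 < w i α) (hμ : ∀ α, 0 < μ α)
    (hM : ∀ α, ∀ y ∈ Icc 0 (N.len α), |h α y 0| ≤ M) : |ρ| ≤ M := by
  -- At a maximum of u the equation gives h(y,0) + ρ ≤ 0, at a minimum the reverse.
  obtain ⟨α, y, hy, hp, hd, -⟩ := hu.exists_max hw
  obtain ⟨β, z, hz, hp', hd'⟩ := hu.exists_min hw
  simp only [hp, hp'] at hd hd'
  rw [div_le_iff₀ (hμ α), zero_mul] at hd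
  rw [le_div_iff₀ (hμ β), zero_mul] at hd'
  have h1 := _root_.abs_le.1 (hM α y hy)
  have h2 := _root_.abs_le.1 (hM β z hz)
  exact _root_.abs_le.2 ⟨by linarith, by linarith⟩

/-- At a maximum of u₁ - u₂ the slopes agree, so the Hamiltonian cancels and the second-order
condition reads (ρ₁ - ρ₂)/μ ≤ 0. -/
theorem le_of_isKirchhoff {μ : A → ℝ} {h : A → ℝ → ℝ → ℝ} {ρ₁ ρ₂ : ℝ}
    (h₁ : N.IsKirchhoff w u₁ p₁ fun α y => (h α y (p₁ α y) + ρ₁) / μ α)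
    (h₂ : N.IsKirchhoff w u₂ p₂ fun α y => (h α y (p₂ α y) + ρ₂) / μ α)
    (hw : ∀ i, ∀ α ∈ N.inc i, 0 < w i α) (hμ : ∀ α, 0 < μ α) : ρ₁ ≤ ρ₂ := by
  obtain ⟨α, y, hy, hp, hd, -⟩ := (h₁.sub h₂).exists_max hw
  rw [sub_eq_zero.1 hp, ← sub_div, div_le_iff₀ (hμ α)] at hd
  linarith

/-- Uniqueness of the ergodic constant, and of the solution up to an additive constant. -/
theorem unique {μ : A → ℝ} {h : A → ℝ → ℝ → ℝ} {ρ₁ ρ₂ : ℝ}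
    (h₁ : N.IsKirchhoff w u₁ p₁ fun α y => (h α y (p₁ α y) + ρ₁) / μ α)
    (h₂ : N.IsKirchhoff w u₂ p₂ fun α y => (h α y (p₂ α y) + ρ₂) / μ α)
    (hw : ∀ i, ∀ α ∈ N.inc i, 0 < w i α) (hμ : ∀ α, 0 < μ α)
    (hh : ∀ α r, ∃ K, ∀ y ∈ Icc 0 (N.len α), ∀ s t, |s| ≤ r → |t| ≤ r →
      |h α y s - h α y t| ≤ K * |s - t|) :
    ρ₁ = ρ₂ ∧ ∃ c, ∀ α, ∀ y ∈ Icc 0 (N.len α), u₁ α y - u₂ α y = c := by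
  have hρ : ρ₁ = ρ₂ :=
    le_antisymm (h₁.le_of_isKirchhoff h₂ hw hμ) (h₂.le_of_isKirchhoff h₁ hw hμ)
  subst hρ
  have hs := h₁.sub h₂
  refine ⟨rfl, ?_⟩
  -- On an edge both slopes are bounded, so the local Lipschitz constant gives |q'| ≤ (K/μ)|q| for
  -- their difference q.
  have hode : ∀ α, ∀ y₀ ∈ Icc 0 (N.len α), p₁ α y₀ - p₂ α y₀ = 0 →
      ∀ y ∈ Icc 0 (N.len α), p₁ α y - p₂ α y = 0 := by
    intro α y₀ hy₀ h0
    obtain ⟨r₁, hr₁⟩ := isCompact_Icc.exists_bound_of_continuousOn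
      (continuousOn_of_forall_hasDerivWithinAt (h₁.hasDeriv' α))
    obtain ⟨r₂, hr₂⟩ := isCompact_Icc.exists_bound_of_continuousOn
      (continuousOn_of_forall_hasDerivWithinAt (h₂.hasDeriv' α))
    obtain ⟨K, hK⟩ := hh α (max r₁ r₂)
    refine eq_zero_of_abs_deriv_le_mul_abs (K := K / μ α) hy₀ (hs.hasDeriv' α) (fun y hy => ?_) h0
    have := hK y hy _ _ ((hr₁ y hy).trans (le_max_left _ _)) ((hr₂ y hy).trans (le_max_right _ _))
    rw [← sub_div, add_sub_add_right_eq_sub, abs_div, abs_of_pos (hμ α), div_mul_eq_mul_div]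
    exact div_le_div_of_nonneg_right this (hμ α).le
  have hconst : ∀ α, ∀ y₀ ∈ Icc 0 (N.len α), p₁ α y₀ - p₂ α y₀ = 0 →
      ∀ y ∈ Icc 0 (N.len α), ∀ z ∈ Icc 0 (N.len α), u₁ α y - u₂ α y = u₁ α z - u₂ α z := by
    intro α y₀ hy₀ h0 y hy z hz
    refine (convex_Icc 0 (N.len α)).is_const_of_fderivWithin_eq_zero
      (f := fun y => u₁ α y - u₂ α y) (𝕜 := ℝ)
      (fun x hx => (hs.hasDeriv α x hx).differentiableWithinAt) (fun x hx => ?_) hy hz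
    have h1 := hs.hasDeriv α x hx
    rw [hode α y₀ hy₀ h0 x hx] at h1
    have h2 := h1.hasFDerivWithinAt.fderivWithin (uniqueDiffOn_Icc (N.len_pos α) x hx)
    rw [h2]
    ext
    simp
  obtain ⟨α, y, hy, hp, -, hmax⟩ := hs.exists_max hw
  obtain ⟨V, hV⟩ := hs.glue
  set c := u₁ α y - u₂ α y with hc
  -- At a vertex where the maximum c is attained all slopes of the difference vanish, so the
  -- difference is constant along every incident edge and the neighbours also attain c.
  have hVc : {i | V i = c} = univ := by
    refine N.eq_univ_of_otherEnd_mem ⟨N.src α, ?_⟩ ?_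
    · change V (N.src α) = c
      rw [← (hV α).1]
      exact hconst α y hy hp _ (N.zero_mem α) _ hy
    · intro i (hi : V i = c) β hβ
      have h0 := hs.outSlope_eq_zero_of_max hw hV (i := i) (by rw [hi]; exact hmax) β hβ
      change V (N.otherEnd i β) = c
      rcases N.mem_inc.1 hβ with rfl | rfl
      · rw [outSlope_src, neg_eq_zero] at h0
        have := hconst β 0 (N.zero_mem β) h0 _ (N.len_mem β) _ (N.zero_mem β)
        rw [(hV β).1, (hV β).2, hi] at this
        simpa [otherEnd] using this
      · rw [outSlope_tgt] at h0
        have := hconst β _ (N.len_mem β) h0 _ (N.zero_mem β) _ (N.len_mem β)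
        rw [(hV β).1, (hV β).2, hi] at this
        simpa [otherEnd, (N.src_ne_tgt β).symm] using this
  refine ⟨c, fun β z hz => ?_⟩
  have hsrc : V (N.src β) = c := (hVc ▸ mem_univ _ : N.src β ∈ {i | V i = c})
  have h0 := hs.outSlope_eq_zero_of_max hw hV (i := N.src β) (by rw [hsrc]; exact hmax) β
    (N.src_mem_inc β)
  rw [outSlope_src, neg_eq_zero] at h0
  rw [hconst β 0 (N.zero_mem β) h0 z hz 0 (N.zero_mem β), (hV β).1, hsrc]

/-- The gradient bound: linear growth of the second derivative in the first one, with a rate that is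
large compared to the lengths and the weights, bounds the first derivative. -/
theorem abs_deriv_le (hu : N.IsKirchhoff w u p dp) (hw1 : ∀ i, ∑ α ∈ N.inc i, w i α = 1)
    {Λ C ω : ℝ} (hΛ : 0 < Λ) (hC : 0 ≤ C) (hω : 0 < ω) (hωw : ∀ i, ∀ α ∈ N.inc i, ω ≤ w i α)
    (hΛω : ∀ α, Real.exp (-(Λ * N.len α)) ≤ ω / 2)
    (hdp : ∀ α, ∀ y ∈ Icc 0 (N.len α), Λ * |p α y| - C ≤ dp α y) :
    ∀ α, ∀ y ∈ Icc 0 (N.len α), |p α y| ≤ 2 * (C / Λ) / ω + C / Λ := by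
  -- The shift by c gives (p - c)' ≥ Λ(p - c) and (p + c)' ≥ -Λ(p + c), the two exponential
  -- inequalities below.
  set c := C / Λ with hc
  have hc0 : 0 ≤ c := by positivity
  have hcΛ : Λ * c = C := by rw [hc]; field_simp
  have hup : ∀ α, ∀ x ∈ Icc 0 (N.len α), ∀ y ∈ Icc 0 (N.len α), x ≤ y →
      (p α x - c) * Real.exp (Λ * (y - x)) ≤ p α y - c := by
    intro α x hx y hy hxy
    refine mul_exp_le_of_mul_le_deriv (fun z hz => (hu.hasDeriv' α z hz).sub_const c)
      (fun z hz => ?_) hx hy hxy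
    have := hdp α z hz
    nlinarith [le_abs_self (p α z)]
  have hlow : ∀ α, ∀ x ∈ Icc 0 (N.len α), ∀ y ∈ Icc 0 (N.len α), x ≤ y →
      (p α x + c) * Real.exp (-Λ * (y - x)) ≤ p α y + c := by
    intro α x hx y hy hxy
    refine mul_exp_le_of_mul_le_deriv (fun z hz => (hu.hasDeriv' α z hz).add_const c)
      (fun z hz => ?_) hx hy hxy
    have := hdp α z hz
    nlinarith [neg_abs_le (p α z)]
  have hIA : ∃ D, (∃ i, ∃ α ∈ N.inc i, N.outSlope p i α = D) ∧
      ∀ i, ∀ α ∈ N.inc i, N.outSlope p i α ≤ D := by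
    have : Nonempty (Σ i, N.inc i) := by
      obtain ⟨i⟩ := N.nonempty_vertices
      obtain ⟨α, hα⟩ := N.inc_nonempty i
      exact ⟨⟨i, α, hα⟩⟩
    obtain ⟨x, hx⟩ := Finite.exists_max fun x : (Σ i, N.inc i) => N.outSlope p x.1 x.2
    exact ⟨_, ⟨x.1, x.2, x.2.2, rfl⟩, fun i α hα => hx ⟨i, α, hα⟩⟩
  obtain ⟨D, ⟨i, α, hα, hD⟩, hmax⟩ := hIA
  have hsrcD : ∀ β, -p β 0 ≤ D := fun β => by
    rw [← N.outSlope_src p]; exact hmax _ _ (N.src_mem_inc β)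
  have htgtD : ∀ β, p β (N.len β) ≤ D := fun β => by
    rw [← N.outSlope_tgt p]; exact hmax _ _ (N.tgt_mem_inc β)
  have hDle : D ≤ 2 * c / ω := by
    by_contra! hlt
    have hD0 : 0 < D := lt_of_le_of_lt (by positivity) hlt
    -- An inward slope s > c at i becomes at least c + (s - c)exp(Λℓ) at the far end, where outward
    -- slopes are at most D. Hence s ≤ c + exp(-Λℓ)D.
    have hin : ∀ β ∈ N.inc i, -N.outSlope p i β ≤ c + ω / 2 * D := by
      intro β hβ
      have hl := (N.len_pos β).le
      have hE : Real.exp (-(Λ * N.len β)) * D ≤ ω / 2 * D :=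
        mul_le_mul_of_nonneg_right (hΛω β) hD0.le
      have hE0 := Real.exp_pos (-(Λ * N.len β))
      rcases N.mem_inc.1 hβ with rfl | rfl
      · rw [outSlope_src, neg_neg]
        have h1 := hup β 0 (N.zero_mem β) _ (N.len_mem β) hl
        have h2 := mul_le_mul_of_nonneg_right h1 hE0.le
        rw [mul_assoc, sub_zero, ← Real.exp_add, add_neg_cancel, Real.exp_zero, mul_one] at h2
        nlinarith [htgtD β]
      · rw [outSlope_tgt]
        have h1 := hlow β 0 (N.zero_mem β) _ (N.len_mem β) hl
        rw [sub_zero, neg_mul] at h1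
        nlinarith [hsrcD β]
    have hk := hu.kirchhoff i
    classical
    have h1 := hw1 i
    rw [← Finset.add_sum_erase _ _ hα] at hk h1
    rw [hD] at hk
    have hwα := hωw i α hα
    have hpos : ∀ β ∈ N.inc i, 0 ≤ w i β := fun β hβ => hω.le.trans (hωw i β hβ)
    have h2 : -∑ β ∈ (N.inc i).erase α, w i β * N.outSlope p i β ≤
        (∑ β ∈ (N.inc i).erase α, w i β) * (c + ω / 2 * D) := by
      rw [← Finset.sum_neg_distrib, Finset.sum_mul]
      refine Finset.sum_le_sum fun β hβ => ?_
      have hβ' := Finset.mem_of_mem_erase hβ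
      have := mul_le_mul_of_nonneg_left (hin β hβ') (hpos β hβ')
      linarith
    -- By Kirchhoff, the outward slope D along α is balanced by inward slopes on the other edges,
    -- whose total weight is at most 1. Since w ≥ ω, half of ωD remains on the left.
    have h3 : w i α * D ≤ c + ω / 2 * D := by
      have h4 : (∑ β ∈ (N.inc i).erase α, w i β) * (c + ω / 2 * D) ≤ 1 * (c + ω / 2 * D) :=
        mul_le_mul_of_nonneg_right (by linarith) (by positivity)
      linarith
    rw [div_lt_iff₀ hω] at hlt
    have h5 := mul_le_mul_of_nonneg_right hwα hD0.le
    linarith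
  intro α y hy
  have hy' : 0 ≤ 2 * c / ω := by positivity
  rw [_root_.abs_le]
  constructor
  · have h1 := hlow α 0 (N.zero_mem α) y hy hy.1
    have hE : Real.exp (-Λ * (y - 0)) ≤ 1 := Real.exp_le_one_iff.2 (by nlinarith [hy.1])
    have hE0 := Real.exp_pos (-Λ * (y - 0))
    by_contra! hlt
    nlinarith [hsrcD α]
  · have h1 := hup α y hy _ (N.len_mem α) hy.2
    have hE : 1 ≤ Real.exp (Λ * (N.len α - y)) := Real.one_le_exp (by nlinarith [hy.2])
    by_contra! hlt
    nlinarith [htgtD α]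

end IsKirchhoff

end Network

/-! ### Existence on the edges: Lipschitz Hamiltonians, then superlinear ones by truncation. -/

theorem exists_primitive {p : ℝ → ℝ} {ℓ : ℝ} (hℓ : 0 < ℓ) (hp : ContinuousOn p (Icc 0 ℓ)) (c : ℝ) :
    ∃ u : ℝ → ℝ, u 0 = c ∧ u ℓ = c + ∫ y in (0 : ℝ)..ℓ, p y ∧
      ∀ y ∈ Icc 0 ℓ, HasDerivWithinAt u (p y) (Icc 0 ℓ) y := by
  set P : ℝ → ℝ := IccExtend hℓ.le ((Icc 0 ℓ).domRestrict p) with hP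
  have hPc : Continuous P := (continuousOn_iff_continuous_domRestrict.1 hp).Icc_extend'
  have hPp : ∀ y ∈ Icc 0 ℓ, P y = p y := fun y hy => IccExtend_of_mem _ _ hy
  refine ⟨fun y => c + ∫ z in (0 : ℝ)..y, P z, by simp, ?_, fun y hy => ?_⟩
  · simp only
    rw [intervalIntegral.integral_congr fun y hy => hPp y (by rwa [uIcc_of_le hℓ.le] at hy)]
  · rw [← hPp y hy]
    exact ((hPc.integral_hasStrictDerivAt 0 y).hasDerivAt.const_add c).hasDerivWithinAt

namespace Network

variable {n : ℕ} {I A : Type*} [Fintype I] [Fintype A] (N : Network n I A)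

/-- Solvability for Hamiltonians that are globally Lipschitz in the gradient. -/
theorem exists_isKirchhoff_of_lipschitz {w : I → A → ℝ} {μ : A → ℝ} {h : A → ℝ → ℝ → ℝ}
    (hw : ∀ i, ∀ α ∈ N.inc i, 0 < w i α) (hμ : ∀ α, 0 < μ α)
    (hh : ∀ α, ∃ L, IsLipschitzField (N.len α) L fun y p => h α y p / μ α) :
    ∃ u p ρ, N.IsKirchhoff w u p fun α y => (h α y (p α y) + ρ) / μ α := by
  classical
  choose L hL using hh
  -- The field as read when travelling away from i; reversing the edge also reverses the sign of the
  -- slope.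
  let k : I → A → ℝ → ℝ → ℝ := fun i α =>
    if i = N.src α then fun y p => h α y p / μ α else fun y p => h α (N.len α - y) (-p) / μ α
  have hk : ∀ i α, IsLipschitzField (N.len α) (L α) (k i α) := by
    intro i α
    simp only [k]
    split_ifs
    exacts [hL α, (hL α).reverse]
  choose T hT using fun i α => (hk i α).exists_shooting (N.len_pos α)
  have hm : ∀ α, ∃ m, 0 ≤ m ∧ ∀ i, ∀ y ∈ Icc 0 (N.len α), |k i α y 0| ≤ m := by
    intro α
    obtain ⟨m, hm⟩ := isCompact_Icc.exists_bound_of_continuousOn ((hL α).continuousOn 0)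
    refine ⟨m, (norm_nonneg _).trans (hm 0 (N.zero_mem α)), fun i y hy => ?_⟩
    simp only [k]
    split_ifs
    · exact hm y hy
    · have := hm (N.len α - y) ⟨by linarith [hy.2], by linarith [hy.1]⟩
      simpa only [neg_zero, Real.norm_eq_abs] using this
  choose m hm0 hm using hm
  have hmle : ∀ α, m α * μ α ≤ ∑ β, m β * μ β := fun α =>
    Finset.single_le_sum (f := fun β => m β * μ β)
      (fun β _ => mul_nonneg (hm0 β) (hμ β).le) (Finset.mem_univ α)
  -- With e = V i - V j, the increment from i to the other end j is -e. `T` gives the slope entering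
  -- the edge at i, so its negative is the outward slope.
  have hsys : IsNodalSystem N.inc N.otherEnd w fun i α e ρ => -T i α (-e) (ρ / μ α) :=
    { connected := fun S hS h => N.eq_univ_of_otherEnd_mem hS h
      nonempty := N.inc_nonempty
      pos := hw
      continuous := fun i α _ => (((hT i α).continuous (N.len_pos α) (hk i α)).comp
        (by fun_prop : Continuous fun z : ℝ × ℝ => (-z.1, z.2 / μ α))).neg
      strictMono := fun i α _ ρ e e' he => neg_lt_neg
        ((hT i α).strictMono (N.len_pos α) (hk i α) (ρ / μ α) (neg_lt_neg he))
      mono := fun i α _ e ρ ρ' hρ => neg_le_neg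
        ((hT i α).antitone (N.len_pos α) (hk i α) (-e)
          (div_le_div_of_nonneg_right hρ (hμ α).le))
      unbounded := fun i α _ ρ M => by
        obtain ⟨d, hd⟩ := (hT i α).exists_le (N.len_pos α) (hk i α) (ρ / μ α) (-M)
        exact ⟨-d, by rw [neg_neg]; linarith⟩
      exists_nonneg := by
        refine ⟨∑ α, m α * μ α, fun i α _ => ?_⟩
        rw [neg_zero, neg_nonneg]
        refine (hT i α).zero_nonpos (N.len_pos α) (hk i α) fun y hy => ?_
        have h1 := (abs_le.1 (hm α i y hy)).1
        have h2 := (le_div_iff₀ (hμ α)).2 (hmle α)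
        linarith
      exists_neg := by
        -- The sum makes ρ/μ at most -m on every edge; the extra -1 makes the inequality strict.
        refine ⟨-(∑ α, m α * μ α) - 1, fun i α _ => ?_⟩
        rw [neg_zero, neg_lt_zero]
        refine (hT i α).zero_pos (N.len_pos α) (hk i α) fun y hy => ?_
        have h1 := (abs_le.1 (hm α i y hy)).2
        have h2 : (-(∑ α, m α * μ α) - 1) / μ α < -m α := by
          rw [div_lt_iff₀ (hμ α)]
          linarith [hmle α]
        linarith }
  have := N.nonempty_vertices
  obtain ⟨V, ρ, hV⟩ := hsys.exists_solution
  choose p hp hp0 hpi using fun α =>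
    (hT (N.src α) α).exists_solution (V (N.tgt α) - V (N.src α)) (ρ / μ α)
  have hksrc : ∀ α, k (N.src α) α = fun y p => h α y p / μ α := fun α => if_pos rfl
  have hktgt : ∀ α, k (N.tgt α) α = fun y p => h α (N.len α - y) (-p) / μ α := fun α =>
    if_neg (N.src_ne_tgt α).symm
  have hp' : ∀ α, IsEdgeSolution (N.len α) (fun y p => h α y p / μ α) (ρ / μ α) (p α) := by
    intro α
    rw [← hksrc]
    exact hp α
  choose u hu0 hul hu using fun α =>
    exists_primitive (N.len_pos α) (hp α).continuousOn (V (N.src α))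
  refine ⟨u, p, ρ, hu, fun α y hy => ?_, ⟨V, fun α => ⟨hu0 α, ?_⟩⟩, fun i => ?_⟩
  · have := hp' α y hy
    rwa [← add_div] at this
  · rw [hul, hpi, add_sub_cancel]
  · rw [← hV i]
    refine Finset.sum_congr rfl fun α hα => ?_
    congr 1
    rcases N.mem_inc.1 hα with rfl | rfl
    · rw [outSlope_src, hp0, otherEnd, if_pos rfl]
      change _ = -T _ α (-(V (N.src α) - V (N.tgt α))) (ρ / μ α)
      rw [neg_sub]
    · have h1 := hT (N.tgt α) α
      rw [hktgt] at h1
      have h2 := h1.final_eq (h := fun y p => h α y p / μ α) (hp' α)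
      rw [outSlope_tgt, otherEnd, if_neg (N.src_ne_tgt α).symm, ← hpi]
      change _ = -T _ α (-∫ y in (0 : ℝ)..N.len α, p α y) (ρ / μ α)
      rw [← h2, neg_neg]

/-- Λ depends only on the lengths and weights, and K only on C besides. This order of quantifiers
lets one K serve truncated problems and whole families of data. -/
theorem exists_gradient_bound {w : I → A → ℝ} (hw : ∀ i, ∀ α ∈ N.inc i, 0 < w i α)
    (hw1 : ∀ i, ∑ α ∈ N.inc i, w i α = 1) :
    ∃ Λ : ℝ, 0 < Λ ∧ ∀ C, 0 ≤ C → ∃ K, 0 ≤ K ∧ ∀ u p dp, N.IsKirchhoff w u p dp →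
      (∀ α, ∀ y ∈ Icc 0 (N.len α), Λ * |p α y| - C ≤ dp α y) →
      ∀ α, ∀ y ∈ Icc 0 (N.len α), |p α y| ≤ K := by
  have hne := N.nonempty_edges
  have hωe : ∃ ω, 0 < ω ∧ ∀ i, ∀ α ∈ N.inc i, ω ≤ w i α := by
    have : Nonempty (Σ i, N.inc i) := by
      obtain ⟨i⟩ := N.nonempty_vertices
      obtain ⟨α, hα⟩ := N.inc_nonempty i
      exact ⟨⟨i, α, hα⟩⟩
    obtain ⟨x, hx⟩ := Finite.exists_min fun x : (Σ i, N.inc i) => w x.1 x.2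
    exact ⟨_, hw x.1 x.2 x.2.2, fun i α hα => hx ⟨i, α, hα⟩⟩
  obtain ⟨ω, hω, hωw⟩ := hωe
  obtain ⟨α₀, hα₀⟩ := Finite.exists_min N.len
  have hl := N.len_pos α₀
  have hΛe : ∃ Λ : ℝ, 0 < Λ ∧ Real.exp (-(Λ * N.len α₀)) ≤ ω / 2 := by
    have h1 : Tendsto (fun Λ : ℝ => Real.exp (-(Λ * N.len α₀))) atTop (𝓝 0) :=
      Real.tendsto_exp_neg_atTop_nhds_zero.comp (tendsto_id.atTop_mul_const hl)
    obtain ⟨Λ, h2, h3⟩ := ((eventually_gt_atTop 0).and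
      (h1.eventually (ge_mem_nhds (half_pos hω)))).exists
    exact ⟨Λ, h2, h3⟩
  obtain ⟨Λ, hΛ, hΛω⟩ := hΛe
  refine ⟨Λ, hΛ, fun C hC => ⟨2 * (C / Λ) / ω + C / Λ, by positivity, fun u p dp hu hdp =>
    hu.abs_deriv_le hw1 hΛ hC hω hωw (fun α => ?_) hdp⟩⟩
  refine le_trans (Real.exp_le_exp.2 ?_) hΛω
  nlinarith [hα₀ α]

/-- Solvability for Hamiltonians of superlinear growth. -/
theorem exists_isKirchhoff {w : I → A → ℝ} {μ : A → ℝ} {h : A → ℝ → ℝ → ℝ}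
    (hw : ∀ i, ∀ α ∈ N.inc i, 0 < w i α) (hw1 : ∀ i, ∑ α ∈ N.inc i, w i α = 1)
    (hμ : ∀ α, 0 < μ α) (hc : ∀ α p, ContinuousOn (fun y => h α y p) (Icc 0 (N.len α)))
    (hh : ∀ α r, ∃ K, ∀ y ∈ Icc 0 (N.len α), ∀ s t, |s| ≤ r → |t| ≤ r →
      |h α y s - h α y t| ≤ K * |s - t|)
    (hgrow : ∀ Λ : ℝ, 0 < Λ → ∃ C, ∀ α, ∀ y ∈ Icc 0 (N.len α), ∀ p,
      Λ * |p| - C ≤ h α y p / μ α) :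
    ∃ u p ρ, N.IsKirchhoff w u p fun α y => (h α y (p α y) + ρ) / μ α := by
  obtain ⟨Λ, hΛ, hbound⟩ := N.exists_gradient_bound hw hw1
  obtain ⟨C, hC⟩ := hgrow Λ hΛ
  choose m hm using fun α => isCompact_Icc.exists_bound_of_continuousOn (hc α 0)
  have hm0 : ∀ α, 0 ≤ m α := fun α => (norm_nonneg _).trans (hm α 0 (N.zero_mem α))
  have hmM : ∀ α, m α ≤ ∑ β, m β := fun α =>
    Finset.single_le_sum (f := m) (fun β _ => hm0 β) (Finset.mem_univ α)
  set M₀ := ∑ β, m β with hM₀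
  have hM₀0 : 0 ≤ M₀ := Finset.sum_nonneg fun β _ => hm0 β
  have hμinv : ∀ α, M₀ / μ α ≤ ∑ β, M₀ / μ β := fun α =>
    Finset.single_le_sum (f := fun β => M₀ / μ β)
      (fun β _ => div_nonneg hM₀0 (hμ β).le) (Finset.mem_univ α)
  -- The second summand absorbs ρ/μ. The bound |ρ| ≤ M₀ does not depend on K because truncation
  -- leaves the values at p = 0 unchanged.
  obtain ⟨K, hK0, hK⟩ := hbound (|C| + ∑ β, M₀ / μ β)
    (add_nonneg (abs_nonneg _) (Finset.sum_nonneg fun β _ => div_nonneg hM₀0 (hμ β).le))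
  -- Beyond K, h is frozen in p and continued with slope Λμ in |p|. Thus g is globally Lipschitz in
  -- p, and g/μ keeps the lower bound Λ|p| - C.
  let g : A → ℝ → ℝ → ℝ := fun α y p =>
    h α y (clamp K p) + Λ * μ α * (|p| - |clamp K p|)
  have hgeq : ∀ α y p, |p| ≤ K → g α y p = h α y p := fun α y p hp => by
    simp only [g]
    rw [clamp_eq_self hp, sub_self, mul_zero, add_zero]
  have hdiv : ∀ α y p, g α y p / μ α = h α y (clamp K p) / μ α + Λ * (|p| - |clamp K p|) := by
    intro α y p
    have := (hμ α).ne'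
    simp only [g]
    field_simp
  obtain ⟨u, p, ρ, hu⟩ := N.exists_isKirchhoff_of_lipschitz (h := g) hw hμ fun α => by
    obtain ⟨k, hk⟩ := hh α K
    replace hk := fun y hy s t hs ht => (hk y hy s t hs ht).trans
      (mul_le_mul_of_nonneg_right (le_abs_self k) (abs_nonneg (s - t)))
    refine ⟨|k| / μ α + 2 * Λ, fun y hy s t => ?_, fun s => ?_⟩
    · rw [hdiv, hdiv]
      have h1 : |h α y (clamp K s) / μ α - h α y (clamp K t) / μ α| ≤ |k| / μ α * |s - t| := by
        rw [← sub_div, abs_div, abs_of_pos (hμ α), div_mul_eq_mul_div]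
        refine div_le_div_of_nonneg_right ?_ (hμ α).le
        exact (hk y hy _ _ (abs_clamp_le hK0 s) (abs_clamp_le hK0 t)).trans
          (mul_le_mul_of_nonneg_left (abs_clamp_sub_clamp_le _ _ _) (abs_nonneg k))
      have h4 : |(|s| - |clamp K s|) - (|t| - |clamp K t|)| ≤ 2 * |s - t| := by
        have h5 := abs_abs_sub_abs_le s t
        have h6 := (abs_abs_sub_abs_le (clamp K s) (clamp K t)).trans
          (abs_clamp_sub_clamp_le K s t)
        rw [abs_le] at h5 h6 ⊢
        constructor <;> linarith [h5.1, h5.2, h6.1, h6.2]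
      have h7 := abs_add_le (h α y (clamp K s) / μ α - h α y (clamp K t) / μ α)
        (Λ * ((|s| - |clamp K s|) - (|t| - |clamp K t|)))
      rw [abs_mul, abs_of_pos hΛ] at h7
      have h8 := mul_le_mul_of_nonneg_left h4 hΛ.le
      rw [show h α y (clamp K s) / μ α + Λ * (|s| - |clamp K s|) -
        (h α y (clamp K t) / μ α + Λ * (|t| - |clamp K t|)) =
        h α y (clamp K s) / μ α - h α y (clamp K t) / μ α +
          Λ * ((|s| - |clamp K s|) - (|t| - |clamp K t|)) by ring]
      linarith
    · simp only [g]
      exact ((hc α _).add continuousOn_const).div_const _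
  have hρ : |ρ| ≤ M₀ := hu.abs_le hw hμ fun α y hy => by
    rw [hgeq α y 0 (by simpa using hK0)]
    exact (hm α y hy).trans (hmM α)
  have hp : ∀ α, ∀ y ∈ Icc 0 (N.len α), |p α y| ≤ K := by
    refine hK u p _ hu fun α y hy => ?_
    rw [add_div, hdiv]
    have h1 := hC α y hy (clamp K (p α y))
    have h2 : -(M₀ / μ α) ≤ ρ / μ α := by
      rw [← neg_div]
      exact div_le_div_of_nonneg_right (abs_le.1 hρ).1 (hμ α).le
    linarith [hμinv α, le_abs_self C]
  refine ⟨u, p, ρ, hu.hasDeriv, fun α y hy => ?_, hu.glue, hu.kirchhoff⟩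
  have := hu.hasDeriv' α y hy
  rwa [hgeq α y _ (hp α y hy)] at this

end Network

/-! ### Translation between edge functions and classical solutions on Γ. -/

namespace Network

variable {n : ℕ} {I A : Type*} [Fintype I] [Fintype A] (N : Network n I A)

theorem uniqueDiffOn_edge (α : A) : UniqueDiffOn ℝ (Icc 0 (N.len α)) :=
  uniqueDiffOn_Icc (N.len_pos α)

variable {N} {μ : A → ℝ} {γ : I → A → ℝ} {H : N.carrier → ℝ → ℝ} {f v : N.carrier → ℝ}
  {q C₀ C₁ ρ : ℝ}

theorem edgeDeriv_zero (v : N.carrier → ℝ) (α : A) (y : ℝ) :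
    N.edgeDeriv 0 v α y = N.onEdge v α y := by
  simp [edgeDeriv]

theorem IsCm.hasDeriv (hv : N.IsCm 2 v) (α : A) {y : ℝ} (hy : y ∈ Icc 0 (N.len α)) :
    HasDerivWithinAt (N.onEdge v α) (N.edgeDeriv 1 v α y) (Icc 0 (N.len α)) y := by
  rw [edgeDeriv, iteratedDerivWithin_one]
  exact ((hv.2 α).differentiableOn (by norm_num) y hy).hasDerivWithinAt

theorem IsCm.hasDeriv' (hv : N.IsCm 2 v) (α : A) {y : ℝ} (hy : y ∈ Icc 0 (N.len α)) :
    HasDerivWithinAt (N.edgeDeriv 1 v α) (N.edgeDeriv 2 v α y) (Icc 0 (N.len α)) y := by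
  rw [edgeDeriv, iteratedDerivWithin_succ]
  exact ((hv.2 α).differentiableOn_iteratedDerivWithin (m := 1) (by norm_num)
    (N.uniqueDiffOn_edge α) y hy).hasDerivWithinAt

theorem IsCm.continuousOn_edgeDeriv_two (hv : N.IsCm 2 v) (α : A) :
    ContinuousOn (N.edgeDeriv 2 v α) (Icc 0 (N.len α)) :=
  (hv.2 α).continuousOn_iteratedDerivWithin (m := 2) le_rfl (N.uniqueDiffOn_edge α)

theorem exists_vertex_values (hv : Continuous v) :
    ∃ V : I → ℝ, ∀ α, N.onEdge v α 0 = V (N.src α) ∧ N.onEdge v α (N.len α) = V (N.tgt α) := by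
  have hmem : ∀ i, N.vertex i ∈ N.carrier := by
    intro i
    obtain ⟨α, rfl | rfl⟩ := N.vertex_endpoint i
    · exact mem_iUnion.2 ⟨α, left_mem_segment _ _ _⟩
    · exact mem_iUnion.2 ⟨α, right_mem_segment _ _ _⟩
  refine ⟨fun i => v ⟨N.vertex i, hmem i⟩, fun α => ⟨?_, ?_⟩⟩
  · rw [N.onEdge_eq_of_continuous hv (N.zero_mem α)]
    exact congrArg v (Subtype.ext (N.param_zero α))
  · rw [N.onEdge_eq_of_continuous hv (N.len_mem α)]
    exact congrArg v (Subtype.ext (N.param_len α))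

namespace IsHamiltonian

theorem continuousOn_comp (hH : N.IsHamiltonian q C₀ C₁ H) {α : A} {p : ℝ → ℝ}
    (hp : ContinuousOn p (Icc 0 (N.len α))) :
    ContinuousOn (fun y => N.hamOnEdge H α y (p y)) (Icc 0 (N.len α)) :=
  (hH.contDiff α).continuousOn.comp (continuousOn_id.prodMk hp) fun _ hy => ⟨hy, trivial⟩

/-- A `C¹` Hamiltonian is Lipschitz on bounded sets. -/
theorem exists_lipschitz (hH : N.IsHamiltonian q C₀ C₁ H) (α : A) (r : ℝ) :
    ∃ K, 0 ≤ K ∧ ∀ y ∈ Icc 0 (N.len α), ∀ z ∈ Icc 0 (N.len α), ∀ s t, |s| ≤ r → |t| ≤ r →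
      |N.hamOnEdge H α y s - N.hamOnEdge H α z t| ≤ K * (|y - z| + |s - t|) := by
  set F : ℝ × ℝ → ℝ := fun z => N.hamOnEdge H α z.1 z.2 with hF
  have hss : Icc 0 (N.len α) ×ˢ Icc (-r) r ⊆ Icc 0 (N.len α) ×ˢ univ :=
    prod_mono_right (subset_univ _)
  have hc := (hH.contDiff α).continuousOn_fderivWithin
    ((N.uniqueDiffOn_edge α).prod uniqueDiffOn_univ) le_rfl
  obtain ⟨K, hK⟩ := (isCompact_Icc.prod isCompact_Icc).exists_bound_of_continuousOn (hc.mono hss)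
  refine ⟨|K|, abs_nonneg K, fun y hy z hz s t hs ht => ?_⟩
  have h1 := Convex.norm_image_sub_le_of_norm_hasFDerivWithin_le
    (f := F) (x := (z, t)) (y := (y, s))
    (fun x hx => (((hH.contDiff α).differentiableOn one_ne_zero x
      (hss hx)).hasFDerivWithinAt).mono hss) hK
    ((convex_Icc 0 (N.len α)).prod (convex_Icc (-r) r)) ⟨hz, abs_le.1 ht⟩ ⟨hy, abs_le.1 hs⟩
  rw [Real.norm_eq_abs] at h1
  refine h1.trans ?_
  have h2 : ‖((y, s) : ℝ × ℝ) - (z, t)‖ ≤ |y - z| + |s - t| := by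
    rw [Prod.mk_sub_mk, Prod.norm_def]
    exact max_le (le_add_of_nonneg_right (abs_nonneg _)) (le_add_of_nonneg_left (abs_nonneg _))
  exact (mul_le_mul_of_nonneg_right (le_abs_self K) (norm_nonneg _)).trans
    (mul_le_mul_of_nonneg_left h2 (abs_nonneg K))

end IsHamiltonian

namespace IsErgodicSolution

/-- The equation is imposed only inside the edges. Both sides are continuous up to the endpoints, so
it extends to them. -/
theorem edgeDeriv_two_eq (hs : N.IsErgodicSolution μ γ H f v ρ) (hμ : ∀ α, 0 < μ α)
    (hH : N.IsHamiltonian q C₀ C₁ H) (hf : N.IsPC f) (α : A) {y : ℝ} (hy : y ∈ Icc 0 (N.len α)) :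
    N.edgeDeriv 2 v α y =
      (N.hamOnEdge H α y (N.edgeDeriv 1 v α y) - N.onEdge f α y + ρ) / μ α := by
  have hp : ContinuousOn (N.edgeDeriv 1 v α) (Icc 0 (N.len α)) :=
    continuousOn_of_forall_hasDerivWithinAt fun y hy => hs.isC2.hasDeriv' α hy
  have heq : EqOn (N.edgeDeriv 2 v α)
      (fun y => (N.hamOnEdge H α y (N.edgeDeriv 1 v α y) - N.onEdge f α y + ρ) / μ α)
      (Ioo 0 (N.len α)) := by
    intro z hz
    have := hs.equation α z hz
    have hμα := (hμ α).ne'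
    simp only
    rw [eq_div_iff hμα]
    linarith
  refine heq.of_subset_closure (hs.isC2.continuousOn_edgeDeriv_two α)
    ((((hH.continuousOn_comp hp).sub (hf α)).add continuousOn_const).div_const _)
    Ioo_subset_Icc_self ?_ hy
  rw [closure_Ioo (N.len_pos α).ne]

theorem isKirchhoff (hs : N.IsErgodicSolution μ γ H f v ρ) (hμ : ∀ α, 0 < μ α)
    (hH : N.IsHamiltonian q C₀ C₁ H) (hf : N.IsPC f) :
    N.IsKirchhoff (fun i α => γ i α * μ α) (N.onEdge v) (N.edgeDeriv 1 v) fun α y =>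
      (N.hamOnEdge H α y (N.edgeDeriv 1 v α y) - N.onEdge f α y + ρ) / μ α where
  hasDeriv α y hy := hs.isC2.hasDeriv α hy
  hasDeriv' α y hy := by
    rw [← hs.edgeDeriv_two_eq hμ hH hf α hy]
    exact hs.isC2.hasDeriv' α hy
  glue := exists_vertex_values hs.isC2.1
  kirchhoff := hs.kirchhoff

end IsErgodicSolution

theorem sum_len_pos (N : Network n I A) : 0 < ∑ α, N.len α :=
  have := N.nonempty_edges
  Finset.sum_pos (fun α _ => N.len_pos α) Finset.univ_nonempty

/-- A solution on the edges gives a solution on the network. -/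
theorem IsKirchhoff.exists_isErgodicSolution {u p : A → ℝ → ℝ} (hμ : ∀ α, 0 < μ α)
    (hH : N.IsHamiltonian q C₀ C₁ H) (hf : N.IsPC f)
    (hu : N.IsKirchhoff (fun i α => γ i α * μ α) u p fun α y =>
      (N.hamOnEdge H α y (p α y) - N.onEdge f α y + ρ) / μ α) :
    ∃ v, N.IsErgodicSolution μ γ H f v ρ := by
  set dp : A → ℝ → ℝ := fun α y =>
    (N.hamOnEdge H α y (p α y) - N.onEdge f α y + ρ) / μ α with hdp
  have hpc : ∀ α, ContinuousOn (p α) (Icc 0 (N.len α)) := fun α =>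
    continuousOn_of_forall_hasDerivWithinAt (hu.hasDeriv' α)
  have hdpc : ∀ α, ContinuousOn (dp α) (Icc 0 (N.len α)) := fun α =>
    (((hH.continuousOn_comp (hpc α)).sub (hf α)).add continuousOn_const).div_const _
  -- The mean of u over Γ; subtracting it changes neither the derivatives nor the gluing.
  set c := (∑ α, ∫ y in (0 : ℝ)..N.len α, u α y) / ∑ α, N.len α with hc
  obtain ⟨V, hV⟩ := hu.glue
  obtain ⟨v, hv, hvu⟩ := N.exists_continuous_glue (u := fun α y => u α y - c)
    (V := fun i => V i - c) (fun α => (hu.continuousOn α).sub continuousOn_const)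
    (fun α => by rw [(hV α).1]) (fun α => by rw [(hV α).2])
  have h0 : ∀ α, EqOn (N.onEdge v α) (fun y => u α y - c) (Icc 0 (N.len α)) := fun α y hy => by
    rw [N.onEdge_eq_of_continuous hv hy, hvu]
  have h1 : ∀ α, EqOn (N.edgeDeriv 1 v α) (p α) (Icc 0 (N.len α)) := fun α y hy => by
    rw [edgeDeriv, iteratedDerivWithin_one, derivWithin_congr (h0 α) (h0 α hy)]
    exact ((hu.hasDeriv α y hy).sub_const c).derivWithin (N.uniqueDiffOn_edge α y hy)
  have h2 : ∀ α, EqOn (N.edgeDeriv 2 v α) (dp α) (Icc 0 (N.len α)) := fun α y hy => by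
    rw [edgeDeriv, iteratedDerivWithin_succ]
    change derivWithin (N.edgeDeriv 1 v α) _ y = _
    rw [derivWithin_congr (h1 α) (h1 α hy)]
    exact (hu.hasDeriv' α y hy).derivWithin (N.uniqueDiffOn_edge α y hy)
  refine ⟨v, ⟨hv, fun α => ?_⟩, fun α y hy => ?_, fun i => ?_, ?_⟩
  · refine contDiffOn_of_continuousOn_differentiableOn_deriv (n := 2) (fun m hm => ?_)
      (fun m hm => ?_)
    · have hm' : m ≤ 2 := by exact_mod_cast hm
      interval_cases m
      · rw [iteratedDerivWithin_zero]
        exact ((hu.continuousOn α).sub continuousOn_const).congr (h0 α)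
      · exact (hpc α).congr (h1 α)
      · exact (hdpc α).congr (h2 α)
    · have hm' : m < 2 := by exact_mod_cast hm
      interval_cases m
      · rw [iteratedDerivWithin_zero]
        exact DifferentiableOn.congr
          (fun y hy => ((hu.hasDeriv α y hy).sub_const c).differentiableWithinAt) (h0 α)
      · exact DifferentiableOn.congr
          (fun y hy => (hu.hasDeriv' α y hy).differentiableWithinAt) (h1 α)
  · have hy' := Ioo_subset_Icc_self hy
    rw [h2 α hy', h1 α hy']
    have := (hμ α).ne'
    simp only [hdp]
    field_simp
    ring
  · rw [← hu.kirchhoff i]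
    refine Finset.sum_congr rfl fun α _ => ?_
    rw [outwardDeriv, outSlope, h1 α (N.zero_mem α), h1 α (N.len_mem α)]
  · have hint : ∀ α, ∫ y in (0 : ℝ)..N.len α, N.onEdge v α y =
        (∫ y in (0 : ℝ)..N.len α, u α y) - N.len α * c := by
      intro α
      have hl := (N.len_pos α).le
      rw [intervalIntegral.integral_congr (g := fun y => u α y - c)
        fun y hy => h0 α (by rwa [uIcc_of_le hl] at hy),
        intervalIntegral.integral_sub
          (ContinuousOn.intervalIntegrable (by rw [uIcc_of_le hl]; exact hu.continuousOn α))
          intervalIntegrable_const]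
      simp
    rw [integral, Finset.sum_congr rfl fun α _ => hint α, Finset.sum_sub_distrib,
      ← Finset.sum_mul, hc, mul_div_cancel₀ _ N.sum_len_pos.ne', sub_self]

theorem IsErgodicSolution.unique {v₁ v₂ : N.carrier → ℝ} {ρ₁ ρ₂ : ℝ}
    (h₁ : N.IsErgodicSolution μ γ H f v₁ ρ₁) (h₂ : N.IsErgodicSolution μ γ H f v₂ ρ₂)
    (hμ : ∀ α, 0 < μ α) (hγ : ∀ i, ∀ α ∈ N.inc i, 0 < γ i α)
    (hH : N.IsHamiltonian q C₀ C₁ H) (hf : N.IsPC f) : v₁ = v₂ ∧ ρ₁ = ρ₂ := by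
  obtain ⟨hρ, c, hc⟩ := IsKirchhoff.unique
    (h := fun α y p => N.hamOnEdge H α y p - N.onEdge f α y)
    (h₁.isKirchhoff hμ hH hf) (h₂.isKirchhoff hμ hH hf)
    (fun i α hα => mul_pos (hγ i α hα) (hμ α)) hμ (fun α r => by
      obtain ⟨K, -, hK⟩ := hH.exists_lipschitz α r
      refine ⟨K, fun y hy s t hs ht => ?_⟩
      have := hK y hy y hy s t hs ht
      rw [sub_self, abs_zero, zero_add] at this
      rwa [sub_sub_sub_cancel_right])
  refine ⟨?_, hρ⟩
  have hint : ∀ {v : N.carrier → ℝ}, N.IsCm 2 v → ∀ α,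
      IntervalIntegrable (N.onEdge v α) MeasureTheory.volume 0 (N.len α) := fun hv α =>
    ContinuousOn.intervalIntegrable (by
      rw [uIcc_of_le (N.len_pos α).le]; exact (hv.2 α).continuousOn)
  have hc0 : c = 0 := by
    have h3 : ∀ α, (∫ y in (0 : ℝ)..N.len α, N.onEdge v₁ α y) -
        ∫ y in (0 : ℝ)..N.len α, N.onEdge v₂ α y = N.len α * c := by
      intro α
      rw [← intervalIntegral.integral_sub (hint h₁.isC2 α) (hint h₂.isC2 α),
        intervalIntegral.integral_congr (g := fun _ => c)
          fun y hy => hc α y (by rwa [uIcc_of_le (N.len_pos α).le] at hy)]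
      simp
    have h4 := h₁.integral_eq_zero
    have h5 := h₂.integral_eq_zero
    rw [integral] at h4 h5
    have h6 := Finset.sum_congr (rfl : (Finset.univ : Finset A) = _) fun α _ => h3 α
    rw [Finset.sum_sub_distrib, h4, h5, sub_self, ← Finset.sum_mul] at h6
    exact (mul_eq_zero.1 h6.symm).resolve_left N.sum_len_pos.ne'
  funext x
  obtain ⟨α, y, rfl⟩ := N.exists_param_eq x
  have := hc α y y.2
  rw [N.onEdge_eq_of_continuous h₁.isC2.1 y.2, N.onEdge_eq_of_continuous h₂.isC2.1 y.2, hc0] at this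
  exact sub_eq_zero.1 this

end Network

/-! ### Superlinear growth and a priori bounds. -/

theorem exists_mul_sub_le_mul_rpow {q C₀ Λ : ℝ} (hq : 1 < q) (hC₀ : 0 < C₀) (hΛ : 0 < Λ) :
    ∃ C, 0 ≤ C ∧ ∀ t, 0 ≤ t → Λ * t - C ≤ C₀ * t ^ q := by
  -- The threshold at which C₀T^(q-1) = Λ: above it the power dominates Λt, below it Λt ≤ ΛT.
  set T := (Λ / C₀) ^ (1 / (q - 1)) with hT
  have hT0 : 0 < T := Real.rpow_pos_of_pos (by positivity) _
  refine ⟨Λ * T, by positivity, fun t ht => ?_⟩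
  rcases le_total t T with h | h
  · have := Real.rpow_nonneg ht q
    nlinarith
  · have ht0 : 0 < t := hT0.trans_le h
    have h1 : Λ / C₀ ≤ t ^ (q - 1) := by
      have h2 := Real.rpow_le_rpow hT0.le h (by linarith : 0 ≤ q - 1)
      rwa [hT, ← Real.rpow_mul (by positivity), one_div_mul_cancel (by linarith),
        Real.rpow_one] at h2
    have h3 : t ^ q = t ^ (q - 1) * t := by
      rw [← Real.rpow_add_one ht0.ne', sub_add_cancel]
    rw [div_le_iff₀ hC₀] at h1
    rw [h3]
    nlinarith [mul_le_mul_of_nonneg_right h1 ht]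

namespace Network

variable {n : ℕ} {I A : Type*} [Fintype I] [Fintype A] {N : Network n I A}
  {μ : A → ℝ} {γ : I → A → ℝ} {H : N.carrier → ℝ → ℝ} {f v : N.carrier → ℝ}
  {q C₀ C₁ ρ : ℝ}

theorem exists_growth (hμ : ∀ α, 0 < μ α) (hq : 1 < q) (hC₀ : 0 < C₀) {Λ : ℝ} (hΛ : 0 < Λ)
    (E : ℝ) : ∃ C, 0 ≤ C ∧ ∀ α, ∀ t x : ℝ, C₀ * |t| ^ q - E ≤ x → Λ * |t| - C ≤ x / μ α := by
  have hsum : ∀ (g : A → ℝ), (∀ α, 0 ≤ g α) → ∀ α, g α ≤ ∑ β, g β := fun g hg α =>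
    Finset.single_le_sum (fun β _ => hg β) (Finset.mem_univ α)
  have hμ0 : 0 ≤ ∑ β, μ β := Finset.sum_nonneg fun β _ => (hμ β).le
  obtain ⟨C, hC, h⟩ := exists_mul_sub_le_mul_rpow hq hC₀
    -- The rate is multiplied by an upper bound for every μ, so that at least Λ remains after
    -- division by μ.
    (show 0 < Λ * (∑ β, μ β + 1) by positivity)
  have hCE : ∀ α, 0 ≤ (C + |E|) / μ α := fun α => div_nonneg (by positivity) (hμ α).le
  refine ⟨∑ α, (C + |E|) / μ α, Finset.sum_nonneg fun α _ => hCE α, fun α t x hx => ?_⟩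
  have h1 := h |t| (abs_nonneg t)
  have h2 := hsum _ (fun α => (hμ α).le) α
  have h3 : Λ * |t| * μ α ≤ Λ * (∑ β, μ β + 1) * |t| := by
    have := mul_le_mul_of_nonneg_left (show μ α ≤ ∑ β, μ β + 1 by linarith)
      (mul_nonneg hΛ.le (abs_nonneg t))
    linarith
  have h4 : Λ * |t| - (C + |E|) / μ α ≤ x / μ α := by
    rw [sub_le_iff_le_add, ← add_div, le_div_iff₀ (hμ α)]
    linarith [le_abs_self E]
  linarith [hsum _ hCE α]

theorem le_maxAbs {g : A → ℝ → ℝ} (hg : ∀ α, ContinuousOn (g α) (Icc 0 (N.len α))) (α : A) {y : ℝ}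
    (hy : y ∈ Icc 0 (N.len α)) : |g α y| ≤ N.maxAbs g := by
  choose m hm using fun α => isCompact_Icc.exists_bound_of_continuousOn (hg α)
  have hm0 : ∀ α, 0 ≤ m α := fun α => (norm_nonneg _).trans (hm α 0 (N.zero_mem α))
  refine le_ciSup (f := fun x : (Σ α : A, Icc (0 : ℝ) (N.len α)) => |g x.1 (x.2 : ℝ)|) ?_
    ⟨α, y, hy⟩
  refine ⟨∑ α, m α, ?_⟩
  rintro _ ⟨x, rfl⟩
  exact (hm x.1 x.2 x.2.2).trans
    (Finset.single_le_sum (fun β _ => hm0 β) (Finset.mem_univ x.1))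

theorem IsHamiltonian.exists_isErgodicSolution (hH : N.IsHamiltonian q C₀ C₁ H) (hf : N.IsPC f)
    (hμ : ∀ α, 0 < μ α) (hγ : ∀ i, ∀ α ∈ N.inc i, 0 < γ i α)
    (hγμ : ∀ i, ∑ α ∈ N.inc i, γ i α * μ α = 1) (hq : 1 < q) (hC₀ : 0 < C₀) :
    ∃ v ρ, N.IsErgodicSolution μ γ H f v ρ := by
  obtain ⟨u, p, ρ, hu⟩ := N.exists_isKirchhoff
    (h := fun α y p => N.hamOnEdge H α y p - N.onEdge f α y)
    (fun i α hα => mul_pos (hγ i α hα) (hμ α)) hγμ hμ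
    (fun α p => (hH.continuousOn_comp continuousOn_const).sub (hf α))
    (fun α r => by
      obtain ⟨K, -, hK⟩ := hH.exists_lipschitz α r
      refine ⟨K, fun y hy s t hs ht => ?_⟩
      have := hK y hy y hy s t hs ht
      rw [sub_self, abs_zero, zero_add] at this
      rwa [sub_sub_sub_cancel_right])
    (fun Λ hΛ => by
      obtain ⟨C, -, hC⟩ := exists_growth hμ hq hC₀ hΛ (C₁ + N.maxAbs (N.onEdge f))
      refine ⟨C, fun α y hy p => hC α p _ ?_⟩
      have h1 := hH.coercive α y hy p
      have h2 := (abs_le.1 (le_maxAbs hf α hy)).2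
      linarith)
  obtain ⟨v, hv⟩ := hu.exists_isErgodicSolution hμ hH hf
  exact ⟨v, ρ, hv⟩

theorem IsErgodicSolution.abs_le (hs : N.IsErgodicSolution μ γ H f v ρ) (hμ : ∀ α, 0 < μ α)
    (hγ : ∀ i, ∀ α ∈ N.inc i, 0 < γ i α) (hH : N.IsHamiltonian q C₀ C₁ H) (hf : N.IsPC f) {M : ℝ}
    (hM : ∀ α, ∀ y ∈ Icc 0 (N.len α), |N.hamOnEdge H α y 0 - N.onEdge f α y| ≤ M) : |ρ| ≤ M :=
  IsKirchhoff.abs_le (h := fun α y p => N.hamOnEdge H α y p - N.onEdge f α y)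
    (hs.isKirchhoff hμ hH hf) (fun i α hα => mul_pos (hγ i α hα) (hμ α)) hμ hM

theorem IsCm.abs_onEdge_sub_le (hv : N.IsCm 2 v) {K : ℝ} {α : A}
    (hK : ∀ y ∈ Icc 0 (N.len α), |N.edgeDeriv 1 v α y| ≤ K) {y z : ℝ} (hy : y ∈ Icc 0 (N.len α))
    (hz : z ∈ Icc 0 (N.len α)) : |N.onEdge v α y - N.onEdge v α z| ≤ K * |y - z| :=
  (convex_Icc 0 (N.len α)).norm_image_sub_le_of_norm_hasDerivWithin_le
    (fun _ hx => hv.hasDeriv α hx) hK hz hy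

/-- A function of class `C²` with mean zero is bounded in terms of its derivative. -/
theorem exists_bound_of_deriv_bound (N : Network n I A) : ∃ D : ℝ, ∀ (v : N.carrier → ℝ) (K : ℝ),
    0 ≤ K → N.IsCm 2 v → N.integral v = 0 →
    (∀ α, ∀ y ∈ Icc 0 (N.len α), |N.edgeDeriv 1 v α y| ≤ K) →
    ∀ α, ∀ y ∈ Icc 0 (N.len α), |N.onEdge v α y| ≤ K * D := by
  obtain ⟨D, hD0, hD⟩ := N.exists_vertex_bound
  set ℓ := ∑ α, N.len α with hℓ
  have hℓ0 : 0 < ℓ := N.sum_len_pos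
  have hle : ∀ α, N.len α ≤ ℓ := fun α =>
    Finset.single_le_sum (fun β _ => (N.len_pos β).le) (Finset.mem_univ α)
  refine ⟨D + 2 * ℓ, fun v K hK hv hi hp α y hy => ?_⟩
  obtain ⟨V, hV⟩ := exists_vertex_values hv.1
  have hVD : ∀ i j, |V i - V j| ≤ K * D := hD V K hK fun β => by
    have := hv.abs_onEdge_sub_le (hp β) (N.len_mem β) (N.zero_mem β)
    rwa [(hV β).1, (hV β).2, sub_zero, abs_of_pos (N.len_pos β)] at this
  have hsrc : ∀ β, ∀ z ∈ Icc 0 (N.len β), |N.onEdge v β z - V (N.src β)| ≤ K * ℓ := by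
    intro β z hz
    have := hv.abs_onEdge_sub_le (hp β) hz (N.zero_mem β)
    rw [(hV β).1, sub_zero, abs_of_nonneg hz.1] at this
    exact this.trans (mul_le_mul_of_nonneg_left (hz.2.trans (hle β)) hK)
  have hosc : ∀ β, ∀ z ∈ Icc 0 (N.len β),
      |N.onEdge v α y - N.onEdge v β z| ≤ K * (D + 2 * ℓ) := by
    intro β z hz
    have h1 := _root_.abs_le.1 (hsrc α y hy)
    have h2 := _root_.abs_le.1 (hsrc β z hz)
    have h3 := _root_.abs_le.1 (hVD (N.src α) (N.src β))
    exact _root_.abs_le.2 ⟨by linarith, by linarith⟩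
  have hint : ∀ β, |N.onEdge v α y * N.len β - ∫ z in (0 : ℝ)..N.len β, N.onEdge v β z| ≤
      K * (D + 2 * ℓ) * N.len β := by
    intro β
    have hl := N.len_pos β
    have h1 : (∫ z in (0 : ℝ)..N.len β, (N.onEdge v α y - N.onEdge v β z)) =
        N.onEdge v α y * N.len β - ∫ z in (0 : ℝ)..N.len β, N.onEdge v β z := by
      rw [intervalIntegral.integral_sub intervalIntegrable_const
        (ContinuousOn.intervalIntegrable (by rw [uIcc_of_le hl.le]; exact (hv.2 β).continuousOn))]
      simp [mul_comm]
    have h2 := intervalIntegral.norm_integral_le_of_norm_le_const (a := 0) (b := N.len β)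
      (f := fun z => N.onEdge v α y - N.onEdge v β z) (C := K * (D + 2 * ℓ)) (fun z hz => by
        rw [uIoc_of_le hl.le] at hz
        exact hosc β z ⟨hz.1.le, hz.2⟩)
    rwa [h1, sub_zero, abs_of_pos hl] at h2
  -- Since v has zero mean, this sum is v(y) times the total length, so the oscillation bounds v(y).
  have hsum : |∑ β, (N.onEdge v α y * N.len β - ∫ z in (0 : ℝ)..N.len β, N.onEdge v β z)| ≤
      ∑ β, K * (D + 2 * ℓ) * N.len β :=
    (Finset.abs_sum_le_sum_abs _ _).trans (Finset.sum_le_sum fun β _ => hint β)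
  rw [integral] at hi
  rw [Finset.sum_sub_distrib, hi, sub_zero, ← Finset.mul_sum, ← Finset.mul_sum, abs_mul, ← hℓ,
    abs_of_pos hℓ0] at hsum
  exact le_of_mul_le_mul_right hsum hℓ0

/-- The a priori bounds for a solution and its first two derivatives. -/
theorem exists_apriori_bounds (N : Network n I A) (hμ : ∀ α, 0 < μ α)
    (hγ : ∀ i, ∀ α ∈ N.inc i, 0 < γ i α) (hγμ : ∀ i, ∑ α ∈ N.inc i, γ i α * μ α = 1)
    (hq : 1 < q) (hC₀ : 0 < C₀) (B : ℝ → ℝ) (R : ℝ) :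
    ∃ Q : ℝ, ∀ (H : N.carrier → ℝ → ℝ) (f : N.carrier → ℝ), N.IsHamiltonian q C₀ C₁ H →
      N.HamBound B H → N.IsPC f → (∀ α, ∀ y ∈ Icc 0 (N.len α), |N.onEdge f α y| ≤ R) →
      ∀ (v : N.carrier → ℝ) (ρ : ℝ), N.IsErgodicSolution μ γ H f v ρ →
        ∀ k ≤ 2, ∀ α, ∀ y ∈ Icc 0 (N.len α), |N.edgeDeriv k v α y| ≤ Q := by
  have hw : ∀ i, ∀ α ∈ N.inc i, 0 < γ i α * μ α := fun i α hα => mul_pos (hγ i α hα) (hμ α)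
  obtain ⟨Λ, hΛ, hgrad⟩ := N.exists_gradient_bound hw hγμ
  -- Besides C₁ from coercivity, the lower bound for H - f + ρ loses R through f and B 0 + R through
  -- ρ.
  obtain ⟨C, hC, hgrow⟩ := exists_growth hμ hq hC₀ hΛ (C₁ + R + (B 0 + R))
  obtain ⟨K, hK, hgrad⟩ := hgrad C hC
  obtain ⟨D, hD⟩ := N.exists_bound_of_deriv_bound
  set M := |B K + R + (B 0 + R)| with hM
  have hMμ : ∀ α, M / μ α ≤ ∑ β, M / μ β := fun α =>
    Finset.single_le_sum (f := fun β => M / μ β)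
      (fun β _ => div_nonneg (abs_nonneg _) (hμ β).le) (Finset.mem_univ α)
  refine ⟨max (K * D) (max K (∑ β, M / μ β)), fun H f hH hB hf hR v ρ hs k hk α y hy => ?_⟩
  have hρ : |ρ| ≤ B 0 + R := hs.abs_le hμ hγ hH hf fun α y hy =>
    (abs_sub _ _).trans (add_le_add (hB α 0 y hy 0 (by simp)) (hR α y hy))
  have hp : ∀ α, ∀ y ∈ Icc 0 (N.len α), |N.edgeDeriv 1 v α y| ≤ K :=
    hgrad _ _ _ (hs.isKirchhoff hμ hH hf) fun α y hy => hgrow α _ _ (by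
      have h1 := hH.coercive α y hy (N.edgeDeriv 1 v α y)
      have h2 := (_root_.abs_le.1 (hR α y hy)).2
      have h3 := (_root_.abs_le.1 hρ).1
      linarith)
  interval_cases k
  · rw [edgeDeriv_zero]
    exact (hD v K hK hs.isC2 hs.integral_eq_zero hp α y hy).trans (le_max_left _ _)
  · exact (hp α y hy).trans ((le_max_left _ _).trans (le_max_right _ _))
  · refine le_trans ?_ ((le_max_right _ _).trans (le_max_right _ _))
    refine le_trans ?_ (hMμ α)
    rw [hs.edgeDeriv_two_eq hμ hH hf α hy, abs_div, abs_of_pos (hμ α)]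
    refine div_le_div_of_nonneg_right (le_trans ?_ (le_abs_self _)) (hμ α).le
    have h1 := hB α K y hy _ (hp α y hy)
    exact (abs_add_le _ _).trans (add_le_add ((abs_sub _ _).trans (add_le_add h1 (hR α y hy))) hρ)

theorem cmNorm_le {m : ℕ} {Q : ℝ}
    (h : ∀ k ≤ m, ∀ α, ∀ y ∈ Icc 0 (N.len α), |N.edgeDeriv k v α y| ≤ Q) :
    N.cmNorm m v ≤ ∑ _α : A, ∑ _k ∈ Finset.range (m + 1), Q := by
  refine Finset.sum_le_sum fun α _ => Finset.sum_le_sum fun k hk => ?_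
  have : Nonempty (Icc (0 : ℝ) (N.len α)) := ⟨⟨0, N.zero_mem α⟩⟩
  exact ciSup_le fun y => h k (Nat.lt_succ_iff.1 (Finset.mem_range.1 hk)) α y y.2

/-! ### Hölder estimates: bounded intervals turn Lipschitz bounds into Hölder ones. -/

theorem abs_sub_le_mul_rpow {σ ℓ y z : ℝ} (hσ : σ < 1) (hy : y ∈ Icc 0 ℓ) (hz : z ∈ Icc 0 ℓ) :
    |y - z| ≤ ℓ ^ (1 - σ) * |y - z| ^ σ := by
  rcases eq_or_ne y z with rfl | hne
  · rw [sub_self, abs_zero]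
    exact mul_nonneg (Real.rpow_nonneg (hy.1.trans hy.2) _) (Real.rpow_nonneg le_rfl _)
  have h0 : 0 < |y - z| := abs_pos.2 (sub_ne_zero.2 hne)
  have hle : |y - z| ≤ ℓ := _root_.abs_le.2 ⟨by linarith [hy.1, hz.2], by linarith [hy.2, hz.1]⟩
  calc |y - z| = |y - z| ^ (1 - σ) * |y - z| ^ σ := by
        rw [← Real.rpow_add h0, sub_add_cancel, Real.rpow_one]
    _ ≤ ℓ ^ (1 - σ) * |y - z| ^ σ :=
        mul_le_mul_of_nonneg_right (Real.rpow_le_rpow h0.le hle (by linarith))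
          (Real.rpow_nonneg h0.le _)

/-- The Hölder estimate for the second derivative of a solution. -/
theorem IsErgodicSolution.holder_edgeDeriv_two (hs : N.IsErgodicSolution μ γ H f v ρ)
    (hμ : ∀ α, 0 < μ α) (hH : N.IsHamiltonian q C₀ C₁ H) (hf : N.IsPC f) {σ K R Q : ℝ} {α : A}
    (hσ : σ < 1) (hK0 : 0 ≤ K)
    (hQ : ∀ k ≤ 2, ∀ y ∈ Icc 0 (N.len α), |N.edgeDeriv k v α y| ≤ Q)
    (hK : ∀ y ∈ Icc 0 (N.len α), ∀ z ∈ Icc 0 (N.len α), ∀ s t, |s| ≤ Q → |t| ≤ Q →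
      |N.hamOnEdge H α y s - N.hamOnEdge H α z t| ≤ K * (|y - z| + |s - t|))
    (hR : ∀ y ∈ Icc 0 (N.len α), ∀ z ∈ Icc 0 (N.len α),
      |N.onEdge f α y - N.onEdge f α z| ≤ R * |y - z| ^ σ) :
    ∀ y ∈ Icc 0 (N.len α), ∀ z ∈ Icc 0 (N.len α),
      |N.edgeDeriv 2 v α y - N.edgeDeriv 2 v α z| ≤
        (K * (1 + Q) * N.len α ^ (1 - σ) + R) / μ α * |y - z| ^ σ := by
  intro y hy z hz
  have hQ0 : 0 ≤ Q := (abs_nonneg _).trans (hQ 0 (by norm_num) y hy)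
  rw [hs.edgeDeriv_two_eq hμ hH hf α hy, hs.edgeDeriv_two_eq hμ hH hf α hz, ← sub_div, abs_div,
    abs_of_pos (hμ α), div_mul_eq_mul_div]
  refine div_le_div_of_nonneg_right ?_ (hμ α).le
  have h1 := hK y hy z hz _ _ (hQ 1 (by norm_num) y hy) (hQ 1 (by norm_num) z hz)
  -- The bound on v'' makes v' Lipschitz, so H(y,v') is Lipschitz in y, and f alone limits the
  -- regularity of v''.
  have h2 : |N.edgeDeriv 1 v α y - N.edgeDeriv 1 v α z| ≤ Q * |y - z| :=
    (convex_Icc 0 (N.len α)).norm_image_sub_le_of_norm_hasDerivWithin_le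
      (fun _ hx => hs.isC2.hasDeriv' α hx) (hQ 2 le_rfl) hz hy
  have h3 := mul_le_mul_of_nonneg_left
    (show |y - z| + |N.edgeDeriv 1 v α y - N.edgeDeriv 1 v α z| ≤ (1 + Q) * |y - z| by linarith) hK0
  have h4 := mul_le_mul_of_nonneg_left (abs_sub_le_mul_rpow hσ hy hz)
    (show 0 ≤ K * (1 + Q) by positivity)
  have h5 := hR y hy z hz
  have h6 := abs_sub (N.hamOnEdge H α y (N.edgeDeriv 1 v α y) -
    N.hamOnEdge H α z (N.edgeDeriv 1 v α z)) (N.onEdge f α y - N.onEdge f α z)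
  rw [show N.hamOnEdge H α y (N.edgeDeriv 1 v α y) - N.onEdge f α y + ρ -
      (N.hamOnEdge H α z (N.edgeDeriv 1 v α z) - N.onEdge f α z + ρ) =
      N.hamOnEdge H α y (N.edgeDeriv 1 v α y) - N.hamOnEdge H α z (N.edgeDeriv 1 v α z) -
        (N.onEdge f α y - N.onEdge f α z) by ring]
  linarith

theorem IsHolderOn.continuousOn {σ ℓ : ℝ} {g : ℝ → ℝ} (hσ : 0 < σ) (hg : IsHolderOn σ ℓ g) :
    ContinuousOn g (Icc 0 ℓ) := by
  obtain ⟨K, hK⟩ := hg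
  intro y hy
  rw [ContinuousWithinAt, tendsto_iff_dist_tendsto_zero]
  have h1 : Tendsto (fun z : ℝ => K * |z - y| ^ σ) (𝓝[Icc 0 ℓ] y) (𝓝 0) := by
    have hc : Continuous fun z : ℝ => K * |z - y| ^ σ :=
      continuous_const.mul ((by fun_prop : Continuous fun z : ℝ => |z - y|).rpow_const
        fun _ => Or.inr hσ.le)
    have := (hc.tendsto y).mono_left (nhdsWithin_le_nhds (s := Icc 0 ℓ))
    simpa [Real.zero_rpow hσ.ne'] using this
  exact squeeze_zero' (Eventually.of_forall fun _ => dist_nonneg)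
    (eventually_nhdsWithin_of_forall fun z hz => hK z hz y hy) h1

theorem IsHolderOn.bddAbove {σ ℓ : ℝ} {g : ℝ → ℝ} (hg : IsHolderOn σ ℓ g) :
    BddAbove (range fun x : Icc (0 : ℝ) ℓ × Icc (0 : ℝ) ℓ =>
      |g x.1 - g x.2| / |(x.1 : ℝ) - x.2| ^ σ) := by
  obtain ⟨K, hK⟩ := hg
  refine ⟨|K|, ?_⟩
  rintro _ ⟨x, rfl⟩
  refine div_le_of_le_mul₀ (Real.rpow_nonneg (abs_nonneg _) _) (abs_nonneg _) ?_
  exact (hK x.1 x.1.2 x.2 x.2.2).trans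
    (mul_le_mul_of_nonneg_right (le_abs_self K) (Real.rpow_nonneg (abs_nonneg _) _))

theorem holderSeminorm_nonneg (σ ℓ : ℝ) (g : ℝ → ℝ) : 0 ≤ holderSeminorm σ ℓ g :=
  Real.iSup_nonneg fun _ => div_nonneg (abs_nonneg _) (Real.rpow_nonneg (abs_nonneg _) _)

theorem IsHolderOn.abs_sub_le {σ ℓ : ℝ} {g : ℝ → ℝ} (hg : IsHolderOn σ ℓ g) :
    ∀ y ∈ Icc 0 ℓ, ∀ z ∈ Icc 0 ℓ, |g y - g z| ≤ holderSeminorm σ ℓ g * |y - z| ^ σ := by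
  intro y hy z hz
  rcases eq_or_ne y z with rfl | hne
  · rw [sub_self, abs_zero]
    exact mul_nonneg (holderSeminorm_nonneg σ ℓ g) (Real.rpow_nonneg (abs_nonneg _) _)
  · rw [← div_le_iff₀ (Real.rpow_pos_of_pos (abs_pos.2 (sub_ne_zero.2 hne)) _)]
    exact le_ciSup hg.bddAbove ((⟨y, hy⟩, ⟨z, hz⟩) : Icc (0 : ℝ) ℓ × Icc (0 : ℝ) ℓ)

theorem IsHolderOn.abs_le_holderNorm {σ ℓ : ℝ} {g : ℝ → ℝ} (hσ : 0 < σ) (hg : IsHolderOn σ ℓ g) :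
    ∀ y ∈ Icc 0 ℓ, |g y| ≤ holderNorm σ ℓ g := by
  intro y hy
  obtain ⟨m, hm⟩ := isCompact_Icc.exists_bound_of_continuousOn (hg.continuousOn hσ)
  have h1 : |g y| ≤ ⨆ y : Icc (0 : ℝ) ℓ, |g y| :=
    le_ciSup (f := fun y : Icc (0 : ℝ) ℓ => |g y|)
      ⟨m, by rintro _ ⟨x, rfl⟩; exact hm x x.2⟩ ⟨y, hy⟩
  exact h1.trans (le_add_of_nonneg_right (holderSeminorm_nonneg σ ℓ g))

theorem holderSeminorm_le_holderNorm (σ ℓ : ℝ) (g : ℝ → ℝ) :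
    holderSeminorm σ ℓ g ≤ holderNorm σ ℓ g :=
  le_add_of_nonneg_left (Real.iSup_nonneg fun _ => abs_nonneg _)

theorem holderSeminorm_le {σ ℓ K : ℝ} {g : ℝ → ℝ} (hK0 : 0 ≤ K)
    (hK : ∀ y ∈ Icc 0 ℓ, ∀ z ∈ Icc 0 ℓ, |g y - g z| ≤ K * |y - z| ^ σ) :
    holderSeminorm σ ℓ g ≤ K :=
  Real.iSup_le (fun x => div_le_of_le_mul₀ (Real.rpow_nonneg (abs_nonneg _) _) hK0
    (hK x.1 x.1.2 x.2 x.2.2)) hK0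

end Network

/-! ### Assembly of the theorem. -/

theorem mainTheorem3 {n : ℕ} {I A : Type*} [Fintype I] [Fintype A] (N : Network n I A)
    (μ : A → ℝ) (hμ : ∀ α, 0 < μ α)
    (γ : I → A → ℝ) (hγ : ∀ i, ∀ α ∈ N.inc i, 0 < γ i α)
    (hγμ : ∀ i, ∑ α ∈ N.inc i, γ i α * μ α = 1)
    (q C₀ C₁ : ℝ) (hq₁ : 1 < q) (hq₂ : q ≤ 2) (hC₀ : 0 < C₀) (hC₁ : 0 < C₁) :
    -- existence and uniqueness, the bound on `ρ`, and Hölder regularity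
    (∀ (H : N.carrier → ℝ → ℝ) (f : N.carrier → ℝ), N.IsHamiltonian q C₀ C₁ H → N.IsPC f →
      (∃! w : (N.carrier → ℝ) × ℝ, N.IsErgodicSolution μ γ H f w.1 w.2) ∧
      ∀ (v : N.carrier → ℝ) (ρ : ℝ), N.IsErgodicSolution μ γ H f v ρ →
        |ρ| ≤ N.maxAbs (fun α y => N.hamOnEdge H α y 0 - N.onEdge f α y) ∧
        ∀ σ ∈ Set.Ioo (0 : ℝ) 1,
          (∀ α, Network.IsHolderOn σ (N.len α) (N.onEdge f α)) → N.IsCmHolder 2 σ v) ∧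
    -- the bound in `C²(Γ)`
    (∀ (B : ℝ → ℝ) (R : ℝ), ∃ C : ℝ, ∀ (H : N.carrier → ℝ → ℝ) (f : N.carrier → ℝ),
      N.IsHamiltonian q C₀ C₁ H → N.HamBound B H →
      N.IsPC f → N.maxAbs (N.onEdge f) ≤ R →
      ∀ (v : N.carrier → ℝ) (ρ : ℝ), N.IsErgodicSolution μ γ H f v ρ → N.cmNorm 2 v ≤ C) ∧
    -- the bound in `C^{2,σ}(Γ)`
    (∀ (B L : ℝ → ℝ), ∀ σ ∈ Set.Ioo (0 : ℝ) 1, ∀ R : ℝ, ∃ C : ℝ,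
      ∀ (H : N.carrier → ℝ → ℝ) (f : N.carrier → ℝ),
      N.IsHamiltonian q C₀ C₁ H → N.HamBound B H → N.HamLipschitz L H →
      (∀ α, Network.IsHolderOn σ (N.len α) (N.onEdge f α)) →
      (∀ α, Network.holderNorm σ (N.len α) (N.onEdge f α) ≤ R) →
      ∀ (v : N.carrier → ℝ) (ρ : ℝ), N.IsErgodicSolution μ γ H f v ρ →
        N.cmHolderNorm 2 σ v ≤ C) := by
  have hA := N.nonempty_edges
  have hL0 : ∀ {L : ℝ → ℝ} {H : N.carrier → ℝ → ℝ}, N.HamLipschitz L H → ∀ α r,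
      ∀ y ∈ Icc 0 (N.len α), ∀ z ∈ Icc 0 (N.len α), ∀ s t, |s| ≤ r → |t| ≤ r →
        |N.hamOnEdge H α y s - N.hamOnEdge H α z t| ≤ |L r| * (|y - z| + |s - t|) :=
    fun hL α r y hy z hz s t hs ht => (hL α r y hy z hz s t hs ht).trans
      (mul_le_mul_of_nonneg_right (le_abs_self _) (by positivity))
  refine ⟨fun H f hH hf => ⟨?_, fun v ρ hs => ⟨?_, fun σ hσ hfσ => ⟨hs.isC2, fun α => ?_⟩⟩⟩,
    fun B R => ?_, fun B L σ hσ R => ?_⟩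
  · obtain ⟨v, ρ, hs⟩ := hH.exists_isErgodicSolution hf hμ hγ hγμ hq₁ hC₀
    refine ⟨(v, ρ), hs, fun w hw => ?_⟩
    obtain ⟨h1, h2⟩ := Network.IsErgodicSolution.unique hw hs hμ hγ hH hf
    exact Prod.ext h1 h2
  · exact hs.abs_le hμ hγ hH hf fun α y hy => Network.le_maxAbs
      (g := fun α y => N.hamOnEdge H α y 0 - N.onEdge f α y)
      (fun β => (hH.continuousOn_comp continuousOn_const).sub (hf β)) α hy
  · have hc : ∀ k ≤ 2, ContinuousOn (N.edgeDeriv k v α) (Icc 0 (N.len α)) := fun k hk =>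
      (hs.isC2.2 α).continuousOn_iteratedDerivWithin (by exact_mod_cast hk) (N.uniqueDiffOn_edge α)
    choose! Q hQ using fun k hk => isCompact_Icc.exists_bound_of_continuousOn (hc k hk)
    obtain ⟨K, hK0, hK⟩ := hH.exists_lipschitz α (max (Q 0) (max (Q 1) (Q 2)))
    exact ⟨_, hs.holder_edgeDeriv_two hμ hH hf hσ.2 hK0 (fun k hk y hy => by
      refine (hQ k hk y hy).trans ?_
      interval_cases k <;> simp) hK (hfσ α).abs_sub_le⟩
  · obtain ⟨Q, hQ⟩ := N.exists_apriori_bounds hμ hγ hγμ hq₁ hC₀ B R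
    exact ⟨_, fun H f hH hB hf hR v ρ hs => Network.cmNorm_le
      (hQ H f hH hB hf (fun α y hy => (Network.le_maxAbs hf α hy).trans hR) v ρ hs)⟩
  · obtain ⟨Q, hQ⟩ := N.exists_apriori_bounds hμ hγ hγμ hq₁ hC₀ B R
    -- The edgewise Hölder constants are summed in absolute value to dominate their supremum over
    -- the edges; Q bounds the slopes, so `L` is needed only at Q.
    refine ⟨(∑ _α : A, ∑ _k ∈ Finset.range (2 + 1), Q) +
      ∑ α, |(|L Q| * (1 + Q) * N.len α ^ (1 - σ) + R) / μ α|,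
      fun H f hH hB hL hfσ hR v ρ hs => ?_⟩
    have hf : N.IsPC f := fun α => (hfσ α).continuousOn hσ.1
    have hQ' := hQ H f hH hB hf
      (fun α y hy => ((hfσ α).abs_le_holderNorm hσ.1 y hy).trans (hR α)) v ρ hs
    refine add_le_add (Network.cmNorm_le hQ') (ciSup_le fun α => ?_)
    refine le_trans ?_ (Finset.single_le_sum
      (f := fun α => |(|L Q| * (1 + Q) * N.len α ^ (1 - σ) + R) / μ α|)
      (fun _ _ => abs_nonneg _) (Finset.mem_univ α))
    refine Network.holderSeminorm_le (abs_nonneg _) fun y hy z hz => ?_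
    have h1 := hs.holder_edgeDeriv_two hμ hH hf hσ.2 (abs_nonneg (L Q))
      (fun k hk y hy => hQ' k hk α y hy) (hL0 hL α Q) (R := R) (fun y hy z hz =>
        ((hfσ α).abs_sub_le y hy z hz).trans (mul_le_mul_of_nonneg_right
          ((Network.holderSeminorm_le_holderNorm _ _ _).trans (hR α))
          (Real.rpow_nonneg (abs_nonneg _) _))) y hy z hz
    exact h1.trans (mul_le_mul_of_nonneg_right (le_abs_self _)
      (Real.rpow_nonneg (abs_nonneg _) _))
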